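/- **Setting.** Let $\mathcal X\subset\mathbb R^n$ be a measurable state space of finite Lebesgue measure, $\mathcal U\subset\mathbb R^m$ a measurable control set of finite Lebesgue measure such that every nonempty relatively open subset of $\mathcal U$ has positive measure, $\mathcal X_{obs}\subset\mathcal X$ relatively open, $\mathcal X_{free}=\mathcal X\setminus\mathcal X_{obs}$, $x_{start}\in\mathcal X_{free}$ and $x_{goal}\in\mathcal X_{goal}\subset\mathcal X_{free}$. The system is $\dot x=f(x,u)$, where for some $K_x,K_u>0$ and all $x_1,x_2\in\mathcal X$, $u_1,u_2\in\mathcal U$, $$\|f(x_1,u_1)-f(x_2,u_1)\|\le K_x\|x_1-x_2\|,\qquad \|f(x_1,u_1)-f(x_1,u_2)\|\le K_u\|u_1-u_2\|.$$ A *trajectory* of duration $T\ge 0$ is a continuous $\mathcal E:[0,T]\to\mathcal X$ with $\mathcal E(t)=\mathcal E(0)+\int_0^t f(\mathcal E(s),\Upsilon(s))\,ds$ for a measurable control function $\Upsilon:[0,T]\to\mathcal U$ (the integrand being integrable); it is *valid* if it stays in $\mathcal X_{free}$, and its *clearance* is the supremum of the $\delta\ge 0$ such that $B_\delta(\mathcal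 E(t))\subset\mathcal X_{free}$ for all $t\in[0,T]$. **The algorithm.** Parameters: $T_{max}>0$; a trajectory cost; real numbers $\gamma,\delta_{hr}$; an exploitation ratio $\mathcal P:\mathbb N\to[0,1]$; and a distance function $d_X$ that satisfies the triangle inequality on $\mathcal X$ and is compatible with the Euclidean topology at each interior point $x$ of $\mathcal X$: $d_X(x,y)\to 0$ and $d_X(y,x)\to0$ as $y\to x$, and for each $\varepsilon>0$ there is $\eta>0$ such that $y\in\mathcal X$, $d_X(y,x)<\eta$ imply $\|y-x\|<\varepsilon$. GBRRT keeps a forward tree $\mathcal G_{for}=(\mathbf V_{for},\mathbf E_{for})$ with root $x_{start}$, a reverse tree $\mathcal G_{rev}$ with root $x_{goal}$, and an initially empty priority queue $\mathbf Q$ of forward nodes. Write $g$ (resp. $h$) for the sum of the edge costs between a forward (resp. reverse) node and its root. Iteration $k=1,2,\dots$ does the following. 1. Put $r_k=\min\bigl(\gamma(\log|\mathbf V_{rev}|/|\mathbf V_{rev}|)^{1/(n+1)},\delta_{hr}\bigr)$. The reverse search subroutine proposes a trajectory ending at a reverse node, or fails. If the proposal is valid, it is added, with its initial node $x_{rev}$,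 to $\mathcal G_{rev}$; then, if the forward node $x$ nearest to $x_{rev}$ satisfies $d_X(x,x_{rev})\le r_k$ and is in $\mathbf Q$, its key is lowered to $d_X(x,x_{rev})+h(x_{rev})$ if that is smaller. 2. Draw $c_{rand}$ uniformly from $[0,1]$. If $c_{rand}<\mathcal P(k)$, pop the node $x_{pop}$ of least key from $\mathbf Q$ (if $\mathbf Q$ is nonempty) and let the exploitation subroutine propose a trajectory starting at $x_{pop}$; if there is no $x_{pop}$ or this fails, let the fast exploration subroutine propose a trajectory starting at a forward node. If $c_{rand}\ge\mathcal P(k)$ or if all of this failed, use random exploration: draw $x_{rand}$, $t$, $u$ uniformly from $\mathcal X$, $[0,T_{max}]$, $\mathcal U$, let $x_{near}$ be a forward node minimizing $d_X(\cdot,x_{rand})$ (the first such node inserted, in case of ties), and propose the trajectory of duration $t$ that starts at $x_{near}$ under the constant control $u$ (no proposal if there is none in $\mathcal X$). 3. If the proposal is valid, it is added, with its final node $x_{for}$, to $\mathcal G_{for}$. If $x_{for}\in\mathcal X_{goal}$ the algorithm returns (and the trees no longer change); otherwise, if the reverse node $x$ nearest to $x_{for}$ satisfies $d_X(x_{for},x)\le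 r_k$, then $x_{for}$ is inserted in $\mathbf Q$ with key $d_X(x_{for},x)+h(x)$. The reverse search, exploitation and fast exploration subroutines are arbitrary; they may depend on the iteration number, the radius $r_k$ (exploitation) and the whole search state, and may be randomized through a seed (best-input propagation is an example). All draws $c_{rand},x_{rand},t,u$ and the seed are independent of each other and across iterations, and identically distributed across iterations. **Theorem.** Suppose that $\mathcal P(k)\le q$ for all $k$, for some constant $q<1$, and that there is a trajectory of positive clearance from $x_{start}$ to a point of the interior of $\mathcal X_{goal}$. Then GBRRT is probabilistically complete: if $\mathcal G_k=(\mathbf V_k,\mathbf E_k)$ denotes the forward tree after $k$ iterations, $$\liminf_{k\to\infty}\ \mathbb P\bigl(\exists\,x_g\in\mathcal X_{goal}\cap\mathbf V_k:\ x_{start}\text{ is connected to }x_g\text{ in }\mathcal G_k\bigr)=1,$$ where $x_{start}$ is connected to $x_g$ if there is a finite sequence of valid trajectories in $\mathbf E_k$, each starting where the previous one ends, leading from $x_{start}$ to $x_g$. Moreover there are constants $a,b>0$ such that for all $k$ the probability that $x_{start}$ is not connected in $\mathcal G_k$ to a vertex in $\mathcal X_{goal}$ is at most $a e^{-bk}$.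 (Probabilities of sets that are not known to be measurable are outer probabilities.) -/

import Mathlib

open MeasureTheory ProbabilityTheory Set Filter Topology
open scoped ENNReal NNReal

namespace GBRRT

/-- A single-query kinodynamic planning problem in dimension `n` with `m`-dimensional controls. -/
structure PlanningProblem (n m : ℕ) where
  /-- The state space, a region of Euclidean space. -/
  stateSpace : Set (EuclideanSpace ℝ (Fin n))
  /-- The set of admissible inputs. -/
  controlSet : Set (EuclideanSpace ℝ (Fin m))
  /-- The right-hand side `f` of `x' = f (x, u)`; only its values on
  `stateSpace × controlSet` matter. -/
  dynamics : EuclideanSpace ℝ (Fin n) → EuclideanSpace ℝ (Fin m) → EuclideanSpace ℝ (Fin n)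
  obstacles : Set (EuclideanSpace ℝ (Fin n))
  goal : Set (EuclideanSpace ℝ (Fin n))
  start : EuclideanSpace ℝ (Fin n)
  /-- The root of the reverse tree. -/
  goalState : EuclideanSpace ℝ (Fin n)
  obstacles_subset : obstacles ⊆ stateSpace
  /-- The obstacle space is relatively open in the state space. -/
  obstacles_open : ∃ O : Set (EuclideanSpace ℝ (Fin n)), IsOpen O ∧ obstacles = O ∩ stateSpace
  start_mem : start ∈ stateSpace \ obstacles
  goal_subset : goal ⊆ stateSpace \ obstacles
  goalState_mem : goalState ∈ goal

variable {n m : ℕ}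

/-- The free space. -/
def PlanningProblem.free (P : PlanningProblem n m) : Set (EuclideanSpace ℝ (Fin n)) :=
  P.stateSpace \ P.obstacles

/-- Lipschitz continuity of the system in the state and in the input. -/
def PlanningProblem.IsLipschitz (P : PlanningProblem n m) : Prop :=
  ∃ Kx Ku : ℝ, 0 < Kx ∧ 0 < Ku ∧
    ∀ x₁ ∈ P.stateSpace, ∀ x₂ ∈ P.stateSpace, ∀ u₁ ∈ P.controlSet, ∀ u₂ ∈ P.controlSet,
      ‖P.dynamics x₁ u₁ - P.dynamics x₂ u₁‖ ≤ Kx * ‖x₁ - x₂‖ ∧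
      ‖P.dynamics x₁ u₁ - P.dynamics x₁ u₂‖ ≤ Ku * ‖u₁ - u₂‖

/-- A trajectory of the system: a continuous curve `[0, duration] → stateSpace` obtained by
integrating the dynamics under a measurable control function `[0, duration] → controlSet`.
The values of `curve` and `control` outside `[0, duration]` are irrelevant. -/
structure Trajectory (P : PlanningProblem n m) where
  duration : ℝ
  curve : ℝ → EuclideanSpace ℝ (Fin n)
  control : ℝ → EuclideanSpace ℝ (Fin m)
  duration_nonneg : 0 ≤ duration
  curve_continuousOn : ContinuousOn curve (Icc 0 duration)
  curve_mem : ∀ t ∈ Icc 0 duration, curve t ∈ P.stateSpace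
  control_aemeasurable : AEMeasurable control (volume.restrict (Icc 0 duration))
  control_mem : ∀ t ∈ Icc 0 duration, control t ∈ P.controlSet
  integrable : IntervalIntegrable (fun s => P.dynamics (curve s) (control s)) volume 0 duration
  integral_eq : ∀ t ∈ Icc 0 duration,
    curve t = curve 0 + ∫ s in (0 : ℝ)..t, P.dynamics (curve s) (control s)

namespace Trajectory

variable {P : PlanningProblem n m}

def initialNode (e : Trajectory P) : EuclideanSpace ℝ (Fin n) := e.curve 0

def finalNode (e : Trajectory P) : EuclideanSpace ℝ (Fin n) := e.curve e.duration

/-- The trajectory stays in the free space, i.e. passes the collision check. -/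
def IsValid (e : Trajectory P) : Prop := ∀ t ∈ Icc 0 e.duration, e.curve t ∈ P.free

/-- The clearance: the largest radius for which all balls centred on the trajectory lie in the
free space. -/
noncomputable def clearance (e : Trajectory P) : ℝ≥0∞ :=
  ⨆ (δ : ℝ≥0) (_ : ∀ t ∈ Icc 0 e.duration, Metric.ball (e.curve t) (δ : ℝ) ⊆ P.free), (δ : ℝ≥0∞)

end Trajectory

/-- A node of a search tree: a state with the cost of the tree path joining it to the root (the
cost-from-start `g` in the forward tree, the cost-to-goal `h` in the reverse tree). -/
structure Node (n : ℕ) where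
  pos : EuclideanSpace ℝ (Fin n)
  cost : ℝ

/-- A search tree, with nodes and edges listed in order of insertion. -/
structure SearchTree (P : PlanningProblem n m) where
  nodes : List (Node n)
  edges : List (Trajectory P)

namespace SearchTree

variable {P : PlanningProblem n m}

/-- The vertex set, as a set of states. -/
def vertices (G : SearchTree P) : Set (EuclideanSpace ℝ (Fin n)) := {x | ∃ v ∈ G.nodes, v.pos = x}

/-- The tree consisting of a root only. -/
def root (P : PlanningProblem n m) (x : EuclideanSpace ℝ (Fin n)) : SearchTree P := ⟨[⟨x, 0⟩], []⟩

def insert (G : SearchTree P) (v : Node n) (e : Trajectory P) : SearchTree P :=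
  ⟨G.nodes ++ [v], G.edges ++ [e]⟩

/-- There is a feasible path from `x` to `y` in the graph: a finite sequence of valid trajectories,
all of them edges of the graph, each starting where the previous one ends. -/
def Connects (G : SearchTree P) (x y : EuclideanSpace ℝ (Fin n)) : Prop :=
  Relation.ReflTransGen
    (fun a b => ∃ e ∈ G.edges, e.IsValid ∧ e.initialNode = a ∧ e.finalNode = b) x y

end SearchTree

/-- The forward tree, the reverse tree, the priority queue (forward nodes with their keys), and
whether the algorithm has already returned a path. -/
structure SearchState (P : PlanningProblem n m) where
  fwd : SearchTree P
  rev : SearchTree P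
  queue : List (Node n × ℝ)
  returned : Prop

def SearchState.init (P : PlanningProblem n m) : SearchState P :=
  ⟨SearchTree.root P P.start, SearchTree.root P P.goalState, [], False⟩

/-- The user-chosen parameters of the algorithm. -/
structure Settings (P : PlanningProblem n m) where
  /-- The maximum propagation time. -/
  maxTime : ℝ
  /-- The distance function on states. -/
  distance : EuclideanSpace ℝ (Fin n) → EuclideanSpace ℝ (Fin n) → ℝ
  /-- The cost of a trajectory. -/
  cost : Trajectory P → ℝ
  /-- The constant `γ` in the shrinking radius. -/
  gain : ℝ
  /-- The heuristic radius, an upper bound of the shrinking radius. -/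
  heuristicRadius : ℝ
  /-- The exploitation probability as a function of the iteration number. -/
  exploitRatio : ℕ → ℝ

/-- The subroutines that generate the reverse edges, the exploitation edges and the fast exploration
edges. They may be randomised (through the seed in `Ξ`), may depend on the iteration number and on
the whole current search state, and may fail (`none`). -/
structure Routines (P : PlanningProblem n m) (Ξ : Type*) where
  /-- Returns a node of the reverse tree and an edge ending there. -/
  revFastExplore : ℕ → SearchState P → Ξ → Option (Node n × Trajectory P)
  /-- Given the node popped from the queue and the current radius, returns an edge starting at that
  node. -/
  forExploit : ℕ → SearchState P → Node n → ℝ → Ξ → Option (Trajectory P)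
  /-- Returns a node of the forward tree and an edge starting there. -/
  forFastExplore : ℕ → SearchState P → Ξ → Option (Node n × Trajectory P)
  revFastExplore_spec : ∀ k s ξ v e, revFastExplore k s ξ = some (v, e) →
    v ∈ s.rev.nodes ∧ e.finalNode = v.pos
  forExploit_spec : ∀ k s v r ξ e, forExploit k s v r ξ = some e → e.initialNode = v.pos
  forFastExplore_spec : ∀ k s ξ v e, forFastExplore k s ξ = some (v, e) →
    v ∈ s.fwd.nodes ∧ e.initialNode = v.pos

/-- The random draws of one iteration: the number `c_rand`, the sampled state, the sampled duration
and the sampled control of the random exploration, and the seed of the other subroutines. -/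
abbrev Draw (n m : ℕ) (Ξ : Type*) : Type _ :=
  ℝ × EuclideanSpace ℝ (Fin n) × ℝ × EuclideanSpace ℝ (Fin m) × Ξ

/-- The law of the draws of one iteration: independent and uniform on `[0, 1]`, the state space,
`[0, maxTime]` and the control set, with an independent seed of law `ν`. -/
noncomputable def drawLaw (P : PlanningProblem n m) (S : Settings P) {Ξ : Type*}
    [MeasurableSpace Ξ] (ν : Measure Ξ) : Measure (Draw n m Ξ) :=
  (cond volume (Icc (0 : ℝ) 1)).prod
    ((cond volume P.stateSpace).prod
      ((cond volume (Icc (0 : ℝ) S.maxTime)).prod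
        ((cond volume P.controlSet).prod ν)))

section Algorithm

variable {P : PlanningProblem n m}

open Classical in
/-- Monte Carlo propagation: the trajectory that starts at `x` and applies the constant control `u`
for the duration `t`. There is none if the solution does not stay in the state space. -/
noncomputable def monteCarloProp (P : PlanningProblem n m) (x : EuclideanSpace ℝ (Fin n)) (t : ℝ)
    (u : EuclideanSpace ℝ (Fin m)) : Option (Trajectory P) :=
  if h : ∃ e : Trajectory P, e.initialNode = x ∧ e.duration = t ∧ ∀ s ∈ Icc 0 t, e.control s = u
  then some h.choose else none

/-- The node of the tree that is nearest to `x`, distances being measured from the node to `x`. -/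
noncomputable def nearestTo (S : Settings P) (G : SearchTree P) (x : EuclideanSpace ℝ (Fin n)) :
    Option (Node n) :=
  G.nodes.argmin fun v => S.distance v.pos x

/-- The node of the tree that is nearest to `x`, distances being measured from `x` to the node. -/
noncomputable def nearestFrom (S : Settings P) (G : SearchTree P) (x : EuclideanSpace ℝ (Fin n)) :
    Option (Node n) :=
  G.nodes.argmin fun v => S.distance x v.pos

/-- Random exploration: sample a state, select its nearest forward node, and propagate from there
with a random constant control for a random duration. -/
noncomputable def forRandomExplore (S : Settings P) (G : SearchTree P)
    (x : EuclideanSpace ℝ (Fin n)) (t : ℝ) (u : EuclideanSpace ℝ (Fin m)) :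
    Option (Node n × Trajectory P) :=
  (nearestTo S G x).bind fun v => (monteCarloProp P v.pos t u).map fun e => (v, e)

/-- The shrinking radius `min (γ (log |V| / |V|) ^ (1 / (n + 1)), δ_hr)`, where `V` is the vertex
set of the reverse tree. -/
noncomputable def radius (S : Settings P) (s : SearchState P) : ℝ :=
  min (S.gain * (Real.log (s.rev.vertices.ncard : ℝ) / (s.rev.vertices.ncard : ℝ)) ^
    ((1 : ℝ) / ((n : ℝ) + 1))) S.heuristicRadius

open Classical in
/-- The insertion of the new forward node `v` into the priority queue. -/
noncomputable def insertToQueue (S : Settings P) (rev : SearchTree P) (Q : List (Node n × ℝ))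
    (v : Node n) (r : ℝ) : List (Node n × ℝ) :=
  match nearestFrom S rev v.pos with
  | none => Q
  | some w =>
    if S.distance v.pos w.pos ≤ r then Q ++ [(v, S.distance v.pos w.pos + w.cost)] else Q

open Classical in
/-- The update of the priority queue by the new reverse node `w`: if the forward node nearest to `w`
is in the queue, its key is decreased to the new value, if that is smaller. -/
noncomputable def updateQueue (S : Settings P) (fwd : SearchTree P) (Q : List (Node n × ℝ))
    (w : Node n) (r : ℝ) : List (Node n × ℝ) :=
  match nearestTo S fwd w.pos with
  | none => Q
  | some v =>
    if S.distance v.pos w.pos ≤ r then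
      Q.map fun p => if p.1 = v then (p.1, min p.2 (S.distance v.pos w.pos + w.cost)) else p
    else Q

open Classical in
/-- Removal of the entry of least key from the priority queue. -/
noncomputable def popQueue (Q : List (Node n × ℝ)) : Option (Node n) × List (Node n × ℝ) :=
  match Q.argmin (fun p => p.2) with
  | none => (none, Q)
  | some p => (some p.1, Q.erase p)

variable {Ξ : Type*}

open Classical in
/-- Expansion of the reverse tree in iteration `k`. -/
noncomputable def expandReverse (S : Settings P) (R : Routines P Ξ) (k : ℕ) (r : ℝ) (ξ : Ξ)
    (s : SearchState P) : SearchState P :=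
  match R.revFastExplore k s ξ with
  | none => s
  | some (v, e) =>
    if e.IsValid then
      let w : Node n := ⟨e.initialNode, v.cost + S.cost e⟩
      { s with rev := s.rev.insert w e, queue := updateQueue S s.fwd s.queue w r }
    else s

open Classical in
/-- The candidate forward edge of iteration `k`, with the forward node at which it starts, and the
priority queue after a possible pop. -/
noncomputable def forwardCandidate (S : Settings P) (R : Routines P Ξ) (k : ℕ) (r : ℝ)
    (d : Draw n m Ξ) (s : SearchState P) :
    Option (Node n × Trajectory P) × List (Node n × ℝ) :=
  match d with
  | (c, x, t, u, ξ) =>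
    if c < S.exploitRatio k then
      let pop := popQueue s.queue
      let s' : SearchState P := { s with queue := pop.2 }
      let exploit : Option (Node n × Trajectory P) :=
        pop.1.bind fun v => (R.forExploit k s' v r ξ).map fun e => (v, e)
      let guided : Option (Node n × Trajectory P) :=
        match exploit with
        | some ve => some ve
        | none => R.forFastExplore k s' ξ
      match guided with
      | some ve => (some ve, pop.2)
      | none => (forRandomExplore S s.fwd x t u, pop.2)
    else (forRandomExplore S s.fwd x t u, s.queue)

open Classical in
/-- Expansion of the forward tree in iteration `k`. -/
noncomputable def expandForward (S : Settings P) (R : Routines P Ξ) (k : ℕ) (r : ℝ)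
    (d : Draw n m Ξ) (s : SearchState P) : SearchState P :=
  match forwardCandidate S R k r d s with
  | (none, Q) => { s with queue := Q }
  | (some (v, e), Q) =>
    if e.IsValid then
      let w : Node n := ⟨e.finalNode, v.cost + S.cost e⟩
      if w.pos ∈ P.goal then
        { s with fwd := s.fwd.insert w e, queue := Q, returned := True }
      else
        { s with fwd := s.fwd.insert w e, queue := insertToQueue S s.rev Q w r }
    else { s with queue := Q }

open Classical in
/-- Iteration `k`. Nothing changes any more once a path has been returned. -/
noncomputable def iteration (S : Settings P) (R : Routines P Ξ) (k : ℕ) (d : Draw n m Ξ)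
    (s : SearchState P) : SearchState P :=
  if s.returned then s
  else expandForward S R k (radius S s) d (expandReverse S R k (radius S s) d.2.2.2.2 s)

/-- The search state after `k` iterations, run with the draws `d 0`, `d 1`, …; the iterations are
numbered from `1`. -/
noncomputable def run (S : Settings P) (R : Routines P Ξ) (d : ℕ → Draw n m Ξ) : ℕ → SearchState P
  | 0 => SearchState.init P
  | k + 1 => iteration S R (k + 1) (d k) (run S R d k)

end Algorithm

/-- The graph connects the start state to one of its vertices in the goal region. -/
def Solved (P : PlanningProblem n m) (G : SearchTree P) : Prop :=
  ∃ xg ∈ P.goal ∩ G.vertices, G.Connects P.start xg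

/-- Probabilistic completeness of an algorithm whose graph after `k` iterations is the random graph
`G k`. -/
def IsProbabilisticallyComplete (P : PlanningProblem n m) {Ω : Type*} [MeasurableSpace Ω]
    (μ : Measure Ω) (G : ℕ → Ω → SearchTree P) : Prop :=
  liminf (fun k => μ {ω | Solved P (G k ω)}) atTop = 1

/-- A distance function on the state space: it satisfies the triangle inequality and, at interior
points of the state space, small distances are the same as small Euclidean distances. It need
neither be symmetric nor measurable. -/
structure IsCompatibleDistance (X : Set (EuclideanSpace ℝ (Fin n)))
    (d : EuclideanSpace ℝ (Fin n) → EuclideanSpace ℝ (Fin n) → ℝ) : Prop where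
  triangle : ∀ x ∈ X, ∀ y ∈ X, ∀ z ∈ X, d x z ≤ d x y + d y z
  tendsto_left : ∀ x ∈ interior X, Tendsto (fun y => d y x) (𝓝 x) (𝓝 0)
  tendsto_right : ∀ x ∈ interior X, Tendsto (fun y => d x y) (𝓝 x) (𝓝 0)
  dist_small : ∀ x ∈ interior X, ∀ ε > 0, ∃ η > 0, ∀ y ∈ X, d y x < η → dist y x < ε

section BestInput

/-! Best-input propagation gives an instance of the subroutines. -/

variable {P : PlanningProblem n m}

/-- The best, for `score`, of the Monte Carlo trajectories from `x` with the sampled durations and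
controls. -/
noncomputable def bestInputProp (P : PlanningProblem n m) {N : ℕ}
    (x : EuclideanSpace ℝ (Fin n)) (samples : Fin N → ℝ × EuclideanSpace ℝ (Fin m))
    (score : Trajectory P → ℝ) : Option (Trajectory P) :=
  (List.ofFn fun j => monteCarloProp P x (samples j).1 (samples j).2).reduceOption.argmin score

open Classical in
/-- Monte Carlo propagation backwards in time: the trajectory that ends at `x` and applies the
constant control `u` for the duration `t`. -/
noncomputable def monteCarloPropRev (P : PlanningProblem n m) (x : EuclideanSpace ℝ (Fin n)) (t : ℝ)
    (u : EuclideanSpace ℝ (Fin m)) : Option (Trajectory P) :=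
  if h : ∃ e : Trajectory P, e.finalNode = x ∧ e.duration = t ∧ ∀ s ∈ Icc 0 t, e.control s = u
  then some h.choose else none

noncomputable def bestInputPropRev (P : PlanningProblem n m) {N : ℕ}
    (x : EuclideanSpace ℝ (Fin n)) (samples : Fin N → ℝ × EuclideanSpace ℝ (Fin m))
    (score : Trajectory P → ℝ) : Option (Trajectory P) :=
  (List.ofFn fun j => monteCarloPropRev P x (samples j).1 (samples j).2).reduceOption.argmin score

theorem bestInputProp_initialNode {N : ℕ} {x : EuclideanSpace ℝ (Fin n)}
    {samples : Fin N → ℝ × EuclideanSpace ℝ (Fin m)} {score : Trajectory P → ℝ} {e : Trajectory P}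
    (h : bestInputProp P x samples score = some e) : e.initialNode = x := by
  have h1 := List.reduceOption_mem_iff.1 (List.argmin_mem (Option.mem_def.2 h))
  obtain ⟨j, hj⟩ := (List.mem_ofFn' _ _).1 h1
  simp only [monteCarloProp] at hj
  split_ifs at hj with h2
  rw [← Option.some.inj hj]
  exact h2.choose_spec.1

theorem bestInputPropRev_finalNode {N : ℕ} {x : EuclideanSpace ℝ (Fin n)}
    {samples : Fin N → ℝ × EuclideanSpace ℝ (Fin m)} {score : Trajectory P → ℝ} {e : Trajectory P}
    (h : bestInputPropRev P x samples score = some e) : e.finalNode = x := by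
  have h1 := List.reduceOption_mem_iff.1 (List.argmin_mem (Option.mem_def.2 h))
  obtain ⟨j, hj⟩ := (List.mem_ofFn' _ _).1 h1
  simp only [monteCarloPropRev] at hj
  split_ifs at hj with h2
  rw [← Option.some.inj hj]
  exact h2.choose_spec.1

/-- The random samples of the best-input subroutines, with `N` trajectories each: for the reverse
search, a state and durations with controls; for the exploitation, durations with controls; for
the fast exploration, a state and durations with controls. -/
abbrev BestInputSeed (n m N : ℕ) : Type :=
  (EuclideanSpace ℝ (Fin n) × (Fin N → ℝ × EuclideanSpace ℝ (Fin m))) ×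
    (Fin N → ℝ × EuclideanSpace ℝ (Fin m)) ×
    (EuclideanSpace ℝ (Fin n) × (Fin N → ℝ × EuclideanSpace ℝ (Fin m)))

open Classical in
/-- The subroutines built on best-input propagation with `N` trajectories. -/
noncomputable def bestInputRoutines (S : Settings P) (N : ℕ) : Routines P (BestInputSeed n m N) where
  revFastExplore _ s ξ :=
    (nearestFrom S s.rev ξ.1.1).bind fun v =>
      (bestInputPropRev P v.pos ξ.1.2 fun e => S.distance ξ.1.1 e.initialNode).map fun e => (v, e)
  forExploit _ s v r ξ :=
    ((s.rev.nodes.filter fun w => decide (S.distance v.pos w.pos ≤ r)).argmin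
      fun w => v.cost + S.distance v.pos w.pos + w.cost).bind fun w =>
        bestInputProp P v.pos ξ.2.1 fun e => S.distance e.finalNode w.pos
  forFastExplore _ s ξ :=
    (nearestTo S s.fwd ξ.2.2.1).bind fun v =>
      (bestInputProp P v.pos ξ.2.2.2 fun e => S.distance e.finalNode ξ.2.2.1).map fun e => (v, e)
  revFastExplore_spec := by
    intro k s ξ v e h
    obtain ⟨w, hw, h⟩ := Option.bind_eq_some_iff.1 h
    obtain ⟨e', he', h⟩ := Option.map_eq_some_iff.1 h
    obtain ⟨rfl, rfl⟩ := Prod.mk.inj h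
    exact ⟨List.argmin_mem (Option.mem_def.2 hw), bestInputPropRev_finalNode he'⟩
  forExploit_spec := by
    intro k s v r ξ e h
    obtain ⟨w, hw, h⟩ := Option.bind_eq_some_iff.1 h
    exact bestInputProp_initialNode h
  forFastExplore_spec := by
    intro k s ξ v e h
    obtain ⟨w, hw, h⟩ := Option.bind_eq_some_iff.1 h
    obtain ⟨e', he', h⟩ := Option.map_eq_some_iff.1 h
    obtain ⟨rfl, rfl⟩ := Prod.mk.inj h
    exact ⟨List.argmin_mem (Option.mem_def.2 hw), bestInputProp_initialNode he'⟩

end BestInput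

end GBRRT

/-!
The search succeeds because random exploration alone can follow a solution path, and it is used in
every iteration with probability at least `1 - q`.

A solution `β` of positive clearance has a control `Υ` that is only measurable, and possibly
unbounded. Its velocity `g s = f (β s, Υ s)` is however integrable, hence `L¹`-close to a continuous
`φ`. On each interval of a fine grid, the control is frozen at `Υ s₀`, where `s₀` is a time at which
`‖g s₀ - φ s₀‖` does not exceed its average over the interval. The total `L¹` defect is then small, so by Grönwall's
inequality (`norm_sub_le_of_constControl`) the resulting path with piecewise constant control stays
close to `β`: `exists_robustStep_chain` gives a finite chain of constant-control steps
(`RobustStep`) from the start into the interior of the goal region. The choice of `s₀` also bounds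
the length of each step, which provides existence by the Picard-Lindelöf theorem.

A robust step from `x` to `y` tolerates perturbations of the initial state, the control and the
duration (`RobustStep.perturb`). Since small distances are small Euclidean distances, once the
tree has a node near `x`, a draw with sampled state near `x` selects a node near `x`. Hence there is
a set `A` of draws, of positive probability, each of which produces a node near `y`, whatever the
subroutines did before (`RobustStep.exists_draws`).

If the tree has no node near `y` after `k` iterations, then it has none near `x` after `k / 2`
iterations, or the draws of the last `k - k / 2` iterations all avoid `A`. The second event has
exponentially small probability by independence, so exponential decay propagates along the chain
(`exponential_decay_step`). This uses only subadditivity for events that depend on the run, so their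
measurability plays no role.
-/

namespace GBRRT

/-! ### An integral form of Grönwall's inequality -/

theorem le_mul_exp_of_le_add_mul_integral {h : ℝ → ℝ} {A K b : ℝ} (hK : 0 ≤ K)
    (hc : ContinuousOn h (Icc 0 b))
    (hle : ∀ t ∈ Icc 0 b, h t ≤ A + K * ∫ s in (0 : ℝ)..t, h s) :
    ∀ t ∈ Icc 0 b, h t ≤ A * Real.exp (K * t) := by
  intro t ht
  have hb : 0 ≤ b := ht.1.trans ht.2
  set g : ℝ → ℝ := IccExtend hb ((Icc 0 b).domRestrict h) with hg
  have hgc : Continuous g := (continuousOn_iff_continuous_domRestrict.1 hc).Icc_extend'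
  have hgh : ∀ s ∈ Icc 0 b, g s = h s := fun s hs => by
    rw [hg, IccExtend_of_mem hb _ hs]; rfl
  have hint : ∀ s ∈ Icc 0 b, ∫ x in (0 : ℝ)..s, h x = ∫ x in (0 : ℝ)..s, g x := fun s hs => by
    refine intervalIntegral.integral_congr fun x hx => ?_
    rw [uIcc_of_le hs.1] at hx
    exact (hgh x ⟨hx.1, hx.2.trans hs.2⟩).symm
  set H : ℝ → ℝ := fun s => A + K * ∫ x in (0 : ℝ)..s, g x with hH
  have hd : ∀ s, HasDerivAt H (K * g s) s := fun s =>
    ((intervalIntegral.integral_hasDerivAt_right (hgc.intervalIntegrable _ _)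
      hgc.aestronglyMeasurable.stronglyMeasurableAtFilter hgc.continuousAt).const_mul K).const_add A
  have hgH : ∀ s ∈ Icc 0 b, g s ≤ H s := fun s hs => by
    rw [hgh s hs]
    have := hle s hs
    rwa [hint s hs] at this
  have key := le_gronwallBound_of_liminf_deriv_right_le (f := H) (f' := fun s => K * g s)
    (δ := A) (K := K) (ε := 0) (a := 0) (b := b)
    (fun s _ => (hd s).continuousAt.continuousWithinAt)
    (fun s _ r hr => (hd s).hasDerivWithinAt.liminf_right_slope_le hr)
    (by simp [hH])
    (fun s hs => by
      rw [add_zero]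
      exact mul_le_mul_of_nonneg_left (hgH s (Ico_subset_Icc_self hs)) hK) t ht
  rw [gronwallBound_ε0, sub_zero] at key
  rw [← hgh t ht]
  exact (hgH t ht).trans key

/-! ### Trajectories with a constant control -/

variable {n m : ℕ} {P : PlanningProblem n m}

/-- The dynamics is Lipschitz in the state, with constant `K` for every admissible control. -/
def PlanningProblem.LipschitzInState (P : PlanningProblem n m) (K : ℝ≥0) : Prop :=
  ∀ u ∈ P.controlSet, LipschitzOnWith K (fun x => P.dynamics x u) P.stateSpace

/-- The control of the trajectory is constantly `u`. -/
def Trajectory.HasConstControl (e : Trajectory P) (u : EuclideanSpace ℝ (Fin m)) : Prop :=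
  ∀ s ∈ Icc 0 e.duration, e.control s = u

theorem Trajectory.HasConstControl.mem {e : Trajectory P} {u : EuclideanSpace ℝ (Fin m)}
    (h : e.HasConstControl u) : u ∈ P.controlSet := by
  have h0 : (0 : ℝ) ∈ Icc 0 e.duration := ⟨le_rfl, e.duration_nonneg⟩
  exact h 0 h0 ▸ e.control_mem 0 h0

/-- Local existence, from the Picard-Lindelöf theorem: the horizon `τ` is admissible as soon as the
speed bound `‖f (x₀, u)‖ + K a` on the ball of radius `a` does not allow to leave the ball. -/
theorem exists_trajectory_constControl {K : ℝ≥0} (hK : P.LipschitzInState K)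
    {x₀ x : EuclideanSpace ℝ (Fin n)} {u : EuclideanSpace ℝ (Fin m)} {a r : ℝ≥0} {τ : ℝ}
    (hball : Metric.closedBall x₀ a ⊆ P.stateSpace) (hu : u ∈ P.controlSet) (hτ : 0 ≤ τ)
    (hx : x ∈ Metric.closedBall x₀ r)
    (hspeed : (‖P.dynamics x₀ u‖ + K * a) * τ ≤ a - r) :
    ∃ e : Trajectory P, e.initialNode = x ∧ e.duration = τ ∧ ∀ s, e.control s = u := by
  have hx₀ : x₀ ∈ Metric.closedBall x₀ (a : ℝ) := Metric.mem_closedBall_self a.2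
  have hlip : LipschitzOnWith K (fun x => P.dynamics x u) (Metric.closedBall x₀ a) :=
    (hK u hu).mono hball
  have hpl : IsPicardLindelof (fun _ : ℝ => fun x => P.dynamics x u)
      (⟨0, le_rfl, hτ⟩ : Icc (0 : ℝ) τ) x₀ a r (‖P.dynamics x₀ u‖₊ + K * a) K :=
    { lipschitzOnWith := fun _ _ => hlip
      continuousOn := fun _ _ => continuousOn_const
      norm_le := fun t _ y hy => by
        have h1 := hlip.norm_sub_le hy hx₀
        have h2 := norm_le_norm_add_norm_sub' (P.dynamics y u) (P.dynamics x₀ u)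
        have h3 : ‖y - x₀‖ ≤ a := mem_closedBall_iff_norm.1 hy
        have h4 : (K : ℝ) * ‖y - x₀‖ ≤ K * a := mul_le_mul_of_nonneg_left h3 K.coe_nonneg
        push_cast
        linarith
      mul_max_le := by
        push_cast
        simpa [max_eq_left hτ] using hspeed }
  obtain ⟨α, hα⟩ := ODE.FunSpace.exists_isFixedPt_next hpl hx
  have heq : ∀ t ∈ Icc 0 τ, α.compProj t = x + ∫ s in (0 : ℝ)..t, P.dynamics (α.compProj s) u := by
    intro t ht
    rw [ODE.FunSpace.compProj_of_mem ht]
    conv_lhs => rw [← hα]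
    rfl
  have hmem : ∀ t, α.compProj t ∈ Metric.closedBall x₀ (a : ℝ) := fun t =>
    α.compProj_mem_closedBall hpl.mul_max_le
  have h0 : α.compProj 0 = x := by simpa using heq 0 ⟨le_rfl, hτ⟩
  have hcont : Continuous fun s => P.dynamics (α.compProj s) u :=
    hlip.continuousOn.comp_continuous α.continuous_compProj hmem
  refine ⟨⟨τ, α.compProj, fun _ => u, hτ, α.continuous_compProj.continuousOn,
    fun t _ => hball (hmem t), aemeasurable_const, fun _ _ => hu,
    hcont.intervalIntegrable _ _, fun t ht => ?_⟩, h0, rfl, fun _ => rfl⟩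
  rw [h0]
  exact heq t ht

/-- Comparison of a trajectory of constant control `u` with an arbitrary trajectory: `v` bounds the
defect between the velocity of the latter and the one that the control `u` would give. -/
theorem norm_sub_le_of_constControl {K : ℝ≥0} (hK : P.LipschitzInState K)
    {e β : Trajectory P} {u : EuclideanSpace ℝ (Fin m)} (he : e.HasConstControl u)
    {b : ℝ} (hb : 0 ≤ b) (hbe : b ≤ e.duration) (hbβ : b ≤ β.duration)
    {v : ℝ → ℝ} (hv : IntervalIntegrable v volume 0 b)
    (hdefect : ∀ s ∈ Icc 0 b,
      ‖P.dynamics (β.curve s) (β.control s) - P.dynamics (β.curve s) u‖ ≤ v s) :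
    ‖e.curve b - β.curve b‖ ≤
      (‖e.curve 0 - β.curve 0‖ + ∫ s in (0 : ℝ)..b, v s) * Real.exp (K * b) := by
  have hc : ContinuousOn (fun s => ‖e.curve s - β.curve s‖) (Icc 0 b) :=
    ((e.curve_continuousOn.mono (Icc_subset_Icc_right hbe)).sub
      (β.curve_continuousOn.mono (Icc_subset_Icc_right hbβ))).norm
  refine le_mul_exp_of_le_add_mul_integral (h := fun s => ‖e.curve s - β.curve s‖) K.coe_nonneg hc ?_ b
    ⟨hb, le_rfl⟩
  intro t ht
  have hsub : uIcc 0 t ⊆ uIcc 0 b := by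
    rw [uIcc_of_le ht.1, uIcc_of_le hb]; exact Icc_subset_Icc_right ht.2
  have hie : IntervalIntegrable (fun s => P.dynamics (e.curve s) (e.control s)) volume 0 t :=
    e.integrable.mono_set (by
      rw [uIcc_of_le ht.1, uIcc_of_le e.duration_nonneg]
      exact Icc_subset_Icc_right (ht.2.trans hbe))
  have hiβ : IntervalIntegrable (fun s => P.dynamics (β.curve s) (β.control s)) volume 0 t :=
    β.integrable.mono_set (by
      rw [uIcc_of_le ht.1, uIcc_of_le β.duration_nonneg]
      exact Icc_subset_Icc_right (ht.2.trans hbβ))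
  have hih : IntervalIntegrable (fun s => ‖e.curve s - β.curve s‖) volume 0 t :=
    (hc.mono (by rw [uIcc_of_le ht.1]; exact Icc_subset_Icc_right ht.2)).intervalIntegrable
  have hv' : IntervalIntegrable v volume 0 t := hv.mono_set hsub
  have hv0 : ∀ s ∈ Icc 0 b, 0 ≤ v s := fun s hs => (norm_nonneg _).trans (hdefect s hs)
  have h1 : e.curve t - β.curve t = (e.curve 0 - β.curve 0) + ∫ s in (0 : ℝ)..t,
      (P.dynamics (e.curve s) (e.control s) - P.dynamics (β.curve s) (β.control s)) := by
    rw [intervalIntegral.integral_sub hie hiβ, e.integral_eq t ⟨ht.1, ht.2.trans hbe⟩,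
      β.integral_eq t ⟨ht.1, ht.2.trans hbβ⟩]
    abel
  have h2 : ‖∫ s in (0 : ℝ)..t,
      (P.dynamics (e.curve s) (e.control s) - P.dynamics (β.curve s) (β.control s))‖ ≤
      ∫ s in (0 : ℝ)..t, (K * ‖e.curve s - β.curve s‖ + v s) := by
    refine intervalIntegral.norm_integral_le_of_norm_le ht.1 ?_ ((hih.const_mul _).add hv')
    refine Eventually.of_forall fun s hs => ?_
    have hs' : s ∈ Icc 0 b := ⟨hs.1.le, hs.2.trans ht.2⟩
    have hse : s ∈ Icc 0 e.duration := ⟨hs'.1, hs'.2.trans hbe⟩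
    have hsβ : s ∈ Icc 0 β.duration := ⟨hs'.1, hs'.2.trans hbβ⟩
    have h3 := (hK u he.mem).norm_sub_le (e.curve_mem s hse) (β.curve_mem s hsβ)
    have h4 := hdefect s hs'
    rw [norm_sub_rev] at h4
    rw [he s hse]
    exact (norm_sub_le_norm_sub_add_norm_sub _ (P.dynamics (β.curve s) u) _).trans
      (add_le_add h3 h4)
  rw [intervalIntegral.integral_add (hih.const_mul _) hv',
    intervalIntegral.integral_const_mul] at h2
  have h5 : ∫ s in (0 : ℝ)..t, v s ≤ ∫ s in (0 : ℝ)..b, v s := by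
    refine intervalIntegral.integral_mono_interval le_rfl ht.1 ht.2 ?_ hv
    refine (ae_restrict_iff' measurableSet_Ioc).2 (Eventually.of_forall fun s hs => ?_)
    exact hv0 s (Ioc_subset_Icc_self hs)
  calc ‖e.curve t - β.curve t‖ ≤ _ := h1 ▸ norm_add_le _ _
    _ ≤ _ := by linarith

/-- A propagation step that random exploration can reproduce: from `x` to `y` under a constant
control, staying at distance more than `a` from the complement of the free space, so short that
the Picard-Lindelöf theorem applies on the ball of radius `a`, with some room to spare. -/
def RobustStep (P : PlanningProblem n m) (K : ℝ≥0) (maxTime : ℝ)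
    (x y : EuclideanSpace ℝ (Fin n)) : Prop :=
  ∃ (u : EuclideanSpace ℝ (Fin m)) (a : ℝ) (e : Trajectory P), 0 < a ∧ e.HasConstControl u ∧
    e.initialNode = x ∧ e.finalNode = y ∧ 0 < e.duration ∧ e.duration ≤ maxTime ∧
    (∀ s ∈ Icc 0 e.duration, Metric.closedBall (e.curve s) a ⊆ P.free) ∧
    (‖P.dynamics x u‖ + K * a) * e.duration < a

/-- All propagations with data close to those of a robust step exist, are valid and end close to
`y`. -/
theorem RobustStep.perturb {K L : ℝ≥0} (hK : P.LipschitzInState K)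
    (hL : ∀ x ∈ P.stateSpace, LipschitzOnWith L (P.dynamics x) P.controlSet)
    {maxTime : ℝ} {x y : EuclideanSpace ℝ (Fin n)} (h : RobustStep P K maxTime x y)
    {ε : ℝ} (hε : 0 < ε) :
    ∃ u ∈ P.controlSet, ∃ τ, ∃ r, 0 < r ∧ r < τ ∧ τ ≤ maxTime ∧ Metric.ball x r ⊆ P.free ∧
      ∀ x' ∈ Metric.ball x r, ∀ u' ∈ Metric.ball u r ∩ P.controlSet, ∀ t ∈ Ioc (τ - r) τ,
        (∃ e : Trajectory P, e.initialNode = x' ∧ e.duration = t ∧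
          ∀ s ∈ Icc 0 t, e.control s = u') ∧
        ∀ e : Trajectory P, e.initialNode = x' → e.duration = t →
          (∀ s ∈ Icc 0 t, e.control s = u') → e.IsValid ∧ e.finalNode ∈ Metric.ball y ε := by
  obtain ⟨u, a, e, ha, heu, rfl, rfl, hτ, hτT, hfree, hspeed⟩ := h
  have hu := heu.mem
  have h0 : (0 : ℝ) ∈ Icc 0 e.duration := ⟨le_rfl, hτ.le⟩
  have hball := hfree 0 h0
  have hX : P.free ⊆ P.stateSpace := sdiff_subset
  set τ := e.duration with hτdef
  set C := Real.exp (K * τ) with hC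
  have hC0 : 0 < C := Real.exp_pos _
  have hx0 : e.initialNode ∈ P.stateSpace := e.curve_mem 0 h0
  -- the endpoint of the reference trajectory moves little in the last moments
  obtain ⟨r₁, hr₁, hr₁'⟩ : ∃ r₁ > 0, ∀ t ∈ Icc 0 τ, |t - τ| < r₁ →
      dist (e.curve t) e.finalNode < ε / 2 := by
    obtain ⟨r₁, hr₁, h⟩ := Metric.continuousOn_iff.1 e.curve_continuousOn τ ⟨hτ.le, le_rfl⟩ (ε / 2)
      (half_pos hε)
    exact ⟨r₁, hr₁, fun t ht h' => h t ht h'⟩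
  -- all other smallness conditions are continuous in `r` and hold at `r = 0`
  have hcond : ∀ᶠ r in 𝓝[>] (0 : ℝ), r < τ ∧ r ≤ a ∧ r < r₁ ∧
      (‖P.dynamics e.initialNode u‖ + L * r + K * a) * τ < a - r ∧
      (r + L * r * τ) * C < a ∧ (r + L * r * τ) * C < ε / 2 := by
    have hc : ∀ (F G : ℝ → ℝ), Continuous F → Continuous G → F 0 < G 0 →
        ∀ᶠ r in 𝓝[>] (0 : ℝ), F r < G r := fun F G hF hG h =>
      nhdsWithin_le_nhds ((hF.continuousAt).eventually_lt hG.continuousAt h)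
    have c1 := hc (fun r => r) (fun _ => τ) (by fun_prop) (by fun_prop) hτ
    have c2 := hc (fun r => r) (fun _ => a) (by fun_prop) (by fun_prop) ha
    have c3 := hc (fun r => r) (fun _ => r₁) (by fun_prop) (by fun_prop) hr₁
    have c4 := hc (fun r => (‖P.dynamics e.initialNode u‖ + L * r + K * a) * τ) (fun r => a - r)
      (by fun_prop) (by fun_prop) (by simpa using hspeed)
    have c5 := hc (fun r => (r + L * r * τ) * C) (fun _ => a) (by fun_prop) (by fun_prop)
      (by simpa using ha)
    have c6 := hc (fun r => (r + L * r * τ) * C) (fun _ => ε / 2) (by fun_prop) (by fun_prop)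
      (by simpa using half_pos hε)
    filter_upwards [c1, c2, c3, c4, c5, c6] with r d1 d2 d3 d4 d5 d6
    exact ⟨d1, d2.le, d3, d4, d5, d6⟩
  obtain ⟨r, ⟨hrτ, hra, hrr₁, hrspeed, hrC, hrε⟩, hr⟩ :=
    (hcond.and self_mem_nhdsWithin).exists
  have hr : 0 < r := hr
  refine ⟨u, hu, τ, r, hr, hrτ, hτT,
    (Metric.ball_subset_closedBall.trans (Metric.closedBall_subset_closedBall hra)).trans hball, ?_⟩
  intro x' hx' u' hu' t ht
  have ht0 : 0 ≤ t := by linarith [ht.1]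
  have hdu : ‖u' - u‖ < r := mem_ball_iff_norm.1 hu'.1
  have hdx : ‖x' - e.initialNode‖ < r := mem_ball_iff_norm.1 hx'
  constructor
  · obtain ⟨e', h1, h2, h3⟩ := exists_trajectory_constControl hK (x₀ := e.initialNode) (x := x')
      (a := ⟨a, ha.le⟩) (r := ⟨r, hr.le⟩) (hball.trans hX) hu'.2 ht0
      (Metric.ball_subset_closedBall hx') (by
        have h1 := (hL _ hx0).norm_sub_le hu'.2 hu
        have h2 := norm_le_norm_add_norm_sub' (P.dynamics e.initialNode u')
          (P.dynamics e.initialNode u)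
        have h3 : (L : ℝ) * ‖u' - u‖ ≤ L * r := mul_le_mul_of_nonneg_left hdu.le L.coe_nonneg
        have h4 : ‖P.dynamics e.initialNode u'‖ + K * a ≤
          ‖P.dynamics e.initialNode u‖ + L * r + K * a := by linarith
        exact (mul_le_mul h4 ht.2 ht0 (by positivity)).trans hrspeed.le)
    exact ⟨e', h1, h2, fun s _ => h3 s⟩
  · intro e' h1 h2 h3
    have he' : e'.HasConstControl u' := by rw [← h2] at h3; exact h3
    have key : ∀ s ∈ Icc 0 t, ‖e'.curve s - e.curve s‖ ≤ (r + L * r * τ) * C := by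
      intro s hs
      have hsτ : s ≤ τ := hs.2.trans ht.2
      have := norm_sub_le_of_constControl hK he' (β := e) hs.1 (hs.2.trans h2.ge) hsτ
        (v := fun _ => L * r) intervalIntegrable_const (fun s' hs' => by
          have hs'' : s' ∈ Icc 0 e.duration := ⟨hs'.1, hs'.2.trans hsτ⟩
          rw [heu s' hs'']
          refine ((hL _ (e.curve_mem s' hs'')).norm_sub_le hu hu'.2).trans ?_
          rw [norm_sub_rev]
          exact mul_le_mul_of_nonneg_left hdu.le L.coe_nonneg)
      refine this.trans (mul_le_mul (add_le_add ?_ ?_) ?_ (Real.exp_pos _).le (by positivity))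
      · have : e'.curve 0 = x' := h1
        rw [this]
        exact hdx.le
      · simp only [intervalIntegral.integral_const, sub_zero, smul_eq_mul]
        rw [mul_comm]
        exact mul_le_mul_of_nonneg_left hsτ (by positivity)
      · exact Real.exp_le_exp.2 (mul_le_mul_of_nonneg_left hsτ K.coe_nonneg)
    constructor
    · intro s hs
      rw [h2] at hs
      refine hfree s ⟨hs.1, hs.2.trans ht.2⟩ ?_
      rw [mem_closedBall_iff_norm]
      exact (key s hs).trans hrC.le
    · have h4 := key t ⟨ht0, le_rfl⟩
      have h5 := hr₁' t ⟨ht0, ht.2⟩ (by rw [abs_sub_lt_iff]; constructor <;> linarith [ht.1, ht.2])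
      rw [Metric.mem_ball]
      have h6 : e'.finalNode = e'.curve t := by rw [Trajectory.finalNode, h2]
      rw [h6]
      rw [← dist_eq_norm] at h4
      linarith [dist_triangle (e'.curve t) (e.curve t) e.finalNode]

/-! ### Approximation of a trajectory by robust steps -/

/-- The restriction of a trajectory to `[a, b]`, with time shifted to start at `0`. -/
noncomputable def Trajectory.segment (β : Trajectory P) {a b : ℝ} (ha : 0 ≤ a) (hab : a ≤ b)
    (hb : b ≤ β.duration) : Trajectory P where
  duration := b - a
  curve s := β.curve (a + s)
  control s := β.control (a + s)
  duration_nonneg := sub_nonneg.2 hab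
  curve_continuousOn := β.curve_continuousOn.comp (by fun_prop) fun s hs =>
    ⟨by linarith [hs.1], by linarith [hs.2]⟩
  curve_mem s hs := β.curve_mem _ ⟨by linarith [hs.1], by linarith [hs.2]⟩
  control_aemeasurable := by
    have h1 : AEMeasurable β.control (volume.restrict (Icc a b)) :=
      β.control_aemeasurable.mono_measure (Measure.restrict_mono (Icc_subset_Icc ha hb) le_rfl)
    have h2 : MeasurePreserving (fun s : ℝ => a + s) (volume.restrict (Icc 0 (b - a)))
        (volume.restrict (Icc a b)) := by
      have := (measurePreserving_add_left (volume : Measure ℝ) a).restrict_preimage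
        (measurableSet_Icc (a := a) (b := b))
      simpa using this
    exact AEMeasurable.comp_quasiMeasurePreserving h1 h2.quasiMeasurePreserving
  control_mem s hs := β.control_mem _ ⟨by linarith [hs.1], by linarith [hs.2]⟩
  integrable := by
    have h : IntervalIntegrable (fun s => P.dynamics (β.curve s) (β.control s)) volume a b :=
      β.integrable.mono_set (by
        rw [uIcc_of_le hab, uIcc_of_le β.duration_nonneg]; exact Icc_subset_Icc ha hb)
    simpa using h.comp_add_left a
  integral_eq t ht := by
    have hi : ∀ s ∈ Icc 0 β.duration,
        IntervalIntegrable (fun s => P.dynamics (β.curve s) (β.control s)) volume 0 s :=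
      fun s hs => β.integrable.mono_set (by
        rw [uIcc_of_le hs.1, uIcc_of_le β.duration_nonneg]; exact Icc_subset_Icc_right hs.2)
    have h1 : a ∈ Icc 0 β.duration := ⟨ha, hab.trans hb⟩
    have h2 : a + t ∈ Icc 0 β.duration := ⟨by linarith [ht.1], by linarith [ht.2]⟩
    rw [intervalIntegral.integral_comp_add_left
      (fun s => P.dynamics (β.curve s) (β.control s)) a, add_zero,
      ← intervalIntegral.integral_interval_sub_left (hi _ h2) (hi _ h1),
      β.integral_eq _ h2, β.integral_eq _ h1]
    abel

/-- A robust step that follows the trajectory `β` on `[t₀, t₁]` with a constant control `u` whose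
defect is bounded by `v`. -/
theorem exists_robustStep {K : ℝ≥0} (hK : P.LipschitzInState K) (β : Trajectory P) {δ : ℝ}
    (hfree : ∀ t ∈ Icc 0 β.duration, Metric.ball (β.curve t) δ ⊆ P.free) {maxTime : ℝ}
    {t₀ t₁ : ℝ} (h₀ : 0 ≤ t₀) (h₀₁ : t₀ < t₁) (h₁ : t₁ ≤ β.duration) (hmax : t₁ - t₀ ≤ maxTime)
    {u : EuclideanSpace ℝ (Fin m)} (hu : u ∈ P.controlSet) {v : ℝ → ℝ}
    (hv : IntervalIntegrable v volume t₀ t₁)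
    (hdefect : ∀ s ∈ Icc t₀ t₁,
      ‖P.dynamics (β.curve s) (β.control s) - P.dynamics (β.curve s) u‖ ≤ v s)
    {y : EuclideanSpace ℝ (Fin n)}
    (hclose : (‖y - β.curve t₀‖ + ∫ s in t₀..t₁, v s) * Real.exp (K * (t₁ - t₀)) < δ / 2)
    (hspeed : (‖P.dynamics y u‖ + K * (δ / 2)) * (t₁ - t₀) < δ / 2) :
    ∃ y', RobustStep P K maxTime y y' ∧
      ‖y' - β.curve t₁‖ ≤ (‖y - β.curve t₀‖ + ∫ s in t₀..t₁, v s) * Real.exp (K * (t₁ - t₀)) := by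
  set τ := t₁ - t₀ with hτ
  have hτ0 : 0 < τ := sub_pos.2 h₀₁
  set B := ‖y - β.curve t₀‖ + ∫ s in t₀..t₁, v s with hB
  have hv0 : ∀ s ∈ Icc t₀ t₁, 0 ≤ v s := fun s hs => (norm_nonneg _).trans (hdefect s hs)
  have hvint : 0 ≤ ∫ s in t₀..t₁, v s := intervalIntegral.integral_nonneg h₀₁.le hv0
  have hB0 : 0 ≤ B := by positivity
  have hδ : 0 < δ / 2 := lt_of_le_of_lt (by positivity) hclose
  have hexp : 1 ≤ Real.exp (K * τ) := Real.one_le_exp (by positivity)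
  have hy : ‖y - β.curve t₀‖ < δ / 2 := by nlinarith
  have hX : P.free ⊆ P.stateSpace := sdiff_subset
  have hsub : ∀ t ∈ Icc 0 β.duration, ∀ z, ‖z - β.curve t‖ < δ / 2 →
      Metric.closedBall z (δ / 2) ⊆ P.free := fun t ht z hz =>
    (Metric.closedBall_subset_ball' (by rw [dist_eq_norm]; linarith)).trans (hfree t ht)
  obtain ⟨e, he0, heτ, heu⟩ := exists_trajectory_constControl hK (x₀ := y) (x := y) (u := u)
    (a := ⟨δ / 2, hδ.le⟩) (r := 0) (τ := τ)
    ((hsub t₀ ⟨h₀, h₀₁.le.trans h₁⟩ y hy).trans hX) hu hτ0.le (by simp)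
    (by
      rw [NNReal.coe_zero, sub_zero]
      exact hspeed.le)
  have heu' : e.HasConstControl u := fun s _ => heu s
  set σ := β.segment h₀ h₀₁.le h₁ with hσ
  have hv' : IntervalIntegrable (fun s => v (t₀ + s)) volume 0 τ := by
    simpa using hv.comp_add_left t₀
  have key : ∀ s ∈ Icc 0 τ, ‖e.curve s - β.curve (t₀ + s)‖ ≤ B * Real.exp (K * τ) := by
    intro s hs
    have h := norm_sub_le_of_constControl hK heu' (β := σ) hs.1 (hs.2.trans heτ.ge) hs.2
      (v := fun s => v (t₀ + s)) (hv'.mono_set (by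
        rw [uIcc_of_le hs.1, uIcc_of_le hτ0.le]; exact Icc_subset_Icc_right hs.2))
      (fun s' hs' => hdefect _ ⟨by linarith [hs'.1], by linarith [hs'.2, hs.2]⟩)
    have h1 : ∫ x in (0 : ℝ)..s, v (t₀ + x) ≤ ∫ x in t₀..t₁, v x := by
      rw [intervalIntegral.integral_comp_add_left v t₀, add_zero]
      refine intervalIntegral.integral_mono_interval le_rfl (by linarith [hs.1])
        (by linarith [hs.2]) ?_ hv
      exact (ae_restrict_iff' measurableSet_Ioc).2
        (Eventually.of_forall fun x hx => hv0 x (Ioc_subset_Icc_self hx))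
    have h2 : ‖e.curve 0 - σ.curve 0‖ = ‖y - β.curve t₀‖ := by
      have h3 : e.curve 0 = y := he0
      have h4 : σ.curve 0 = β.curve t₀ := by simp [hσ, Trajectory.segment]
      rw [h3, h4]
    rw [h2] at h
    refine h.trans (mul_le_mul (by linarith) ?_ (Real.exp_pos _).le hB0)
    exact Real.exp_le_exp.2 (mul_le_mul_of_nonneg_left hs.2 K.coe_nonneg)
  refine ⟨e.finalNode, ⟨u, δ / 2, e, hδ, heu', he0, rfl, heτ ▸ hτ0, heτ ▸ hmax, ?_, ?_⟩, ?_⟩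
  · intro s hs
    rw [heτ] at hs
    exact hsub (t₀ + s) ⟨by linarith [hs.1], by linarith [hs.2]⟩ _ ((key s hs).trans_lt hclose)
  · rw [heτ]
    exact hspeed
  · have h := key τ ⟨hτ0.le, le_rfl⟩
    rw [show t₀ + τ = t₁ by rw [hτ]; ring] at h
    rw [Trajectory.finalNode, heτ]
    exact h

/-- A trajectory of positive clearance is followed, up to an arbitrarily small error at the end, by
a chain of robust steps. On each interval of a fine uniform grid, the control is frozen at a time
`s` at which the velocity `g` of the trajectory is, compared with the average over the interval,
close to a fixed continuous `L¹`-approximation `φ` of `g`; no regularity or boundedness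
of the control is needed. -/
theorem exists_robustStep_chain {K : ℝ≥0} (hK : P.LipschitzInState K) (β : Trajectory P) {δ : ℝ}
    (hδ : 0 < δ) (hfree : ∀ t ∈ Icc 0 β.duration, Metric.ball (β.curve t) δ ⊆ P.free)
    {maxTime : ℝ} (hmax : 0 < maxTime) {ε : ℝ} (hε : 0 < ε) :
    ∃ y, Relation.ReflTransGen (RobustStep P K maxTime) β.initialNode y ∧
      dist y β.finalNode < ε := by
  rcases β.duration_nonneg.eq_or_lt with hT0 | hT
  · refine ⟨β.initialNode, .refl, ?_⟩
    rw [Trajectory.finalNode, ← hT0, Trajectory.initialNode, dist_self]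
    exact hε
  set T := β.duration with hTdef
  set g : ℝ → EuclideanSpace ℝ (Fin n) := fun s => P.dynamics (β.curve s) (β.control s) with hg
  set C := Real.exp (K * T) with hC
  have hC0 : 0 < C := Real.exp_pos _
  set ε' := min ε (δ / 2) with hε'
  have hε'0 : 0 < ε' := lt_min hε (by linarith)
  -- the total defect will be at most `(2 + 2 T) η`
  obtain ⟨η, hη0, hηε, hηδ⟩ : ∃ η > 0, (2 * η + 2 * η * T) * C < ε' ∧ η < δ / 4 := by
    have h1 : ∀ᶠ η in 𝓝 (0 : ℝ), (2 * η + 2 * η * T) * C < ε' :=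
      ContinuousAt.eventually_lt (by fun_prop) continuousAt_const (by simpa using hε'0)
    have h2 : ∀ᶠ η in 𝓝 (0 : ℝ), η < δ / 4 := gt_mem_nhds (by linarith)
    obtain ⟨η, ⟨h3, h4⟩, h5⟩ :=
      (((h1.and h2).filter_mono nhdsWithin_le_nhds).and
        (self_mem_nhdsWithin (s := Ioi (0 : ℝ)))).exists
    exact ⟨η, h5, h3, h4⟩
  have hgi : Integrable g (volume.restrict (Ioc 0 T)) :=
    (intervalIntegrable_iff_integrableOn_Ioc_of_le hT.le).1 β.integrable
  obtain ⟨φ, hφη, hφi⟩ := hgi.exists_boundedContinuous_integral_sub_le hη0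
  set w : ℝ → ℝ := fun s => ‖g s - φ s‖ with hw
  have hwi : IntervalIntegrable w volume 0 T :=
    (intervalIntegrable_iff_integrableOn_Ioc_of_le hT.le).2 (hgi.sub hφi).norm
  have hwT : ∫ s in (0 : ℝ)..T, w s ≤ η := by
    rw [intervalIntegral.integral_of_le hT.le]
    exact hφη
  have hwi' : ∀ {a b : ℝ}, a ∈ Icc 0 T → b ∈ Icc 0 T → IntervalIntegrable w volume a b :=
    fun ha hb => hwi.mono_set (by rw [uIcc_of_le hT.le]; exact uIcc_subset_Icc ha hb)
  obtain ⟨d₁, hd₁, hφ⟩ := Metric.uniformContinuousOn_iff.1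
    (isCompact_Icc.uniformContinuousOn_of_continuous
      (φ.continuous.continuousOn (s := Icc 0 T))) η hη0
  obtain ⟨d₂, hd₂, hβ⟩ := Metric.uniformContinuousOn_iff.1
    (isCompact_Icc.uniformContinuousOn_of_continuous β.curve_continuousOn)
    (min (η / (K + 1)) (δ / 2)) (lt_min (by positivity) (by linarith))
  -- the mesh of the grid
  obtain ⟨N, hN⟩ : ∃ N : ℕ, ∀ h : ℝ, h = T / (N + 1 : ℝ) →
      h < d₁ ∧ h < d₂ ∧ h < maxTime ∧ h * (‖φ‖ + K * δ + K * (δ / 2)) < δ / 4 := by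
    have h0 : Tendsto (fun N : ℕ => T / (N + 1 : ℝ)) atTop (𝓝 0) := by
      have := (tendsto_one_div_add_atTop_nhds_zero_nat (𝕜 := ℝ)).const_mul T
      simpa only [mul_one_div, mul_zero] using this
    have h1 := h0.eventually (gt_mem_nhds hd₁)
    have h2 := h0.eventually (gt_mem_nhds hd₂)
    have h3 := h0.eventually (gt_mem_nhds hmax)
    have h4 : ∀ᶠ N : ℕ in atTop, T / (N + 1 : ℝ) * (‖φ‖ + K * δ + K * (δ / 2)) < δ / 4 := by
      have := h0.mul_const (‖φ‖ + K * δ + K * (δ / 2))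
      rw [zero_mul] at this
      exact this.eventually (gt_mem_nhds (by linarith))
    obtain ⟨N, h5, h6, h7, h8⟩ := (h1.and (h2.and (h3.and h4))).exists
    exact ⟨N, fun h hh => hh ▸ ⟨h5, h6, h7, h8⟩⟩
  set h := T / (N + 1 : ℝ) with hh
  obtain ⟨hhd₁, hhd₂, hhmax, hhspeed⟩ := hN h rfl
  have hN0 : (0 : ℝ) < N + 1 := by positivity
  have hh0 : 0 < h := div_pos hT hN0
  have hhT : (N + 1 : ℝ) * h = T := by rw [hh]; field_simp
  set ψ : ℝ → ℝ := fun t => 2 * (∫ s in (0 : ℝ)..t, w s) + 2 * η * t with hψ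
  have hψT : ψ T ≤ 2 * η + 2 * η * T := by simp only [hψ]; linarith
  have hw0 : ∀ s, 0 ≤ w s := fun s => norm_nonneg _
  have claim : ∀ i : ℕ, (i : ℝ) ≤ N + 1 → ∃ y,
      Relation.ReflTransGen (RobustStep P K maxTime) β.initialNode y ∧
      ‖y - β.curve (i * h)‖ ≤ ψ (i * h) * Real.exp (K * (i * h)) := by
    intro i
    induction i with
    | zero => exact fun _ => ⟨β.initialNode, .refl, by simp [Trajectory.initialNode, hψ]⟩
    | succ i ih =>
      intro hi
      push_cast at hi
      obtain ⟨y, hy, hyi⟩ := ih (by linarith)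
      set t₀ : ℝ := i * h with ht₀
      set t₁ : ℝ := ((i + 1 : ℕ) : ℝ) * h with ht₁
      have ht₁' : t₁ = t₀ + h := by rw [ht₁, ht₀]; push_cast; ring
      have ht₀0 : 0 ≤ t₀ := by positivity
      have ht₁T : t₁ ≤ T := by
        rw [ht₁, ← hhT]
        push_cast
        exact mul_le_mul_of_nonneg_right hi hh0.le
      have hm₀ : t₀ ∈ Icc 0 T := ⟨ht₀0, by linarith⟩
      have hm₁ : t₁ ∈ Icc 0 T := ⟨by linarith, ht₁T⟩
      have h01 : t₁ - t₀ = h := by linarith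
      have hsub : Icc t₀ t₁ ⊆ Icc 0 T := Icc_subset_Icc ht₀0 ht₁T
      set I := ∫ s in t₀..t₁, w s with hI
      have hI0 : 0 ≤ I := intervalIntegral.integral_nonneg (by linarith) fun s _ => hw0 s
      have hIη : I ≤ η := by
        refine (intervalIntegral.integral_mono_interval ht₀0 (by linarith) ht₁T ?_ hwi).trans hwT
        exact Eventually.of_forall hw0
      have hψ01 : ψ t₁ = ψ t₀ + (2 * I + 2 * η * h) := by
        have := intervalIntegral.integral_add_adjacent_intervals
          (hwi' (left_mem_Icc.2 hT.le) hm₀) (hwi' hm₀ hm₁)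
        simp only [hψ]
        rw [← this, hI]
        have e1 : t₁ = t₀ + h := ht₁'
        linear_combination 2 * η * e1
      have hψ1T : ψ t₁ ≤ ψ T := by
        have : ∫ s in (0 : ℝ)..t₁, w s ≤ ∫ s in (0 : ℝ)..T, w s :=
          intervalIntegral.integral_mono_interval le_rfl hm₁.1 ht₁T (Eventually.of_forall hw0) hwi
        have h2 : 2 * η * t₁ ≤ 2 * η * T := mul_le_mul_of_nonneg_left ht₁T (by positivity)
        simp only [hψ]
        linarith
      have hψ0 : 0 ≤ ψ t₀ := by
        have : 0 ≤ ∫ s in (0 : ℝ)..t₀, w s :=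
          intervalIntegral.integral_nonneg ht₀0 fun s _ => hw0 s
        simp only [hψ]
        positivity
      -- the time at which the control is frozen
      obtain ⟨s₀, hs₀, hws₀⟩ : ∃ s ∈ Icc t₀ t₁, h * w s ≤ I := by
        have hvol : volume (Ioc t₀ t₁) = ENNReal.ofReal h := by rw [Real.volume_Ioc, h01]
        obtain ⟨s, hs, hle⟩ := exists_le_setAverage (μ := volume) (s := Ioc t₀ t₁) (f := w)
          (by rw [hvol]; simpa using hh0) (by rw [hvol]; exact ENNReal.ofReal_ne_top)
          ((intervalIntegrable_iff_integrableOn_Ioc_of_le (by linarith)).1 (hwi' hm₀ hm₁))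
        refine ⟨s, Ioc_subset_Icc_self hs, ?_⟩
        rw [setAverage_eq, Measure.real, hvol, ENNReal.toReal_ofReal hh0.le, smul_eq_mul,
          ← intervalIntegral.integral_of_le (by linarith)] at hle
        calc h * w s ≤ h * (h⁻¹ * I) := mul_le_mul_of_nonneg_left hle hh0.le
          _ = I := by field_simp
      have hs₀T := hsub hs₀
      set u := β.control s₀ with hu
      have huU : u ∈ P.controlSet := β.control_mem s₀ hs₀T
      have hdist : ∀ s ∈ Icc t₀ t₁, dist s s₀ ≤ h := fun s hs => by
        rw [Real.dist_eq, abs_le]; constructor <;> linarith [hs.1, hs.2, hs₀.1, hs₀.2]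
      have hcurve : ∀ s ∈ Icc t₀ t₁, ‖β.curve s - β.curve s₀‖ < min (η / (K + 1)) (δ / 2) :=
        fun s hs => by
          rw [← dist_eq_norm]
          exact hβ s (hsub hs) s₀ hs₀T ((hdist s hs).trans_lt hhd₂)
      set v : ℝ → ℝ := fun s => w s + (w s₀ + 2 * η) with hv
      have hdefect : ∀ s ∈ Icc t₀ t₁,
          ‖P.dynamics (β.curve s) (β.control s) - P.dynamics (β.curve s) u‖ ≤ v s := by
        intro s hs
        have e1 : P.dynamics (β.curve s) (β.control s) - P.dynamics (β.curve s) u =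
            ((g s - φ s) + (φ s - φ s₀)) + ((φ s₀ - g s₀) +
              (P.dynamics (β.curve s₀) u - P.dynamics (β.curve s) u)) := by
          simp only [hg, hu]; abel
        have e2 : ‖φ s - φ s₀‖ ≤ η := by
          rw [← dist_eq_norm]
          exact (hφ s (hsub hs) s₀ hs₀T ((hdist s hs).trans_lt hhd₁)).le
        have e3 : ‖P.dynamics (β.curve s₀) u - P.dynamics (β.curve s) u‖ ≤ η := by
          refine ((hK u huU).norm_sub_le (β.curve_mem s₀ hs₀T)
            (β.curve_mem s (hsub hs))).trans ?_
          have e4 := (hcurve s hs).le.trans (min_le_left _ _)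
          rw [norm_sub_rev]
          calc (K : ℝ) * ‖β.curve s - β.curve s₀‖ ≤ (K + 1) * (η / (K + 1)) :=
                mul_le_mul (by linarith) e4 (norm_nonneg _) (by positivity)
            _ = η := by field_simp
        have e5 : ‖φ s₀ - g s₀‖ = w s₀ := norm_sub_rev _ _
        rw [e1]
        refine (norm_add_le _ _).trans ?_
        have e6 := norm_add_le (g s - φ s) (φ s - φ s₀)
        have e7 := norm_add_le (φ s₀ - g s₀)
          (P.dynamics (β.curve s₀) u - P.dynamics (β.curve s) u)
        simp only [hv, hw] at e5 ⊢
        linarith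
      have hvi : IntervalIntegrable v volume t₀ t₁ := (hwi' hm₀ hm₁).add intervalIntegrable_const
      have hvI : ∫ s in t₀..t₁, v s ≤ 2 * I + 2 * η * h := by
        simp only [hv]
        rw [intervalIntegral.integral_add (hwi' hm₀ hm₁) intervalIntegrable_const,
          intervalIntegral.integral_const, h01, smul_eq_mul]
        linarith
      have hbound : (‖y - β.curve t₀‖ + ∫ s in t₀..t₁, v s) * Real.exp (K * (t₁ - t₀)) ≤
          ψ t₁ * Real.exp (K * t₁) := by
        have e1 : Real.exp (K * t₁) = Real.exp (K * t₀) * Real.exp (K * (t₁ - t₀)) := by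
          rw [← Real.exp_add]; ring_nf
        have e2 : 1 ≤ Real.exp (K * t₀) := Real.one_le_exp (by positivity)
        rw [e1, ← mul_assoc]
        refine mul_le_mul_of_nonneg_right ?_ (Real.exp_pos _).le
        rw [hψ01, add_mul]
        refine add_le_add hyi (hvI.trans ?_)
        exact le_mul_of_one_le_right (by positivity) e2
      have hbound' : ψ t₁ * Real.exp (K * t₁) < ε' := by
        refine lt_of_le_of_lt (mul_le_mul (hψ1T.trans hψT) ?_ (Real.exp_pos _).le
          (by positivity)) hηε
        exact Real.exp_le_exp.2 (mul_le_mul_of_nonneg_left ht₁T K.coe_nonneg)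
      have hclose := (hbound.trans_lt hbound').trans_le (min_le_right _ _)
      have hyball : ‖y - β.curve t₀‖ < δ / 2 := by
        have e0 : 0 ≤ ∫ s in t₀..t₁, v s := intervalIntegral.integral_nonneg (by linarith)
          fun s hs => (norm_nonneg _).trans (hdefect s hs)
        have e1 : 1 ≤ Real.exp (K * (t₁ - t₀)) := Real.one_le_exp (by rw [h01]; positivity)
        have e2 := le_mul_of_one_le_right (add_nonneg (norm_nonneg (y - β.curve t₀)) e0) e1
        linarith
      have hspeed : (‖P.dynamics y u‖ + K * (δ / 2)) * (t₁ - t₀) < δ / 2 := by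
        have hyX : y ∈ P.stateSpace := (hfree t₀ hm₀ (by
          rw [mem_ball_iff_norm]; linarith)).1
        have e1 := (hK u huU).norm_sub_le hyX (β.curve_mem s₀ hs₀T)
        have e2 : ‖y - β.curve s₀‖ ≤ δ := by
          have e3 := (hcurve t₀ (left_mem_Icc.2 (by linarith))).le.trans (min_le_right _ _)
          have e4 := norm_sub_le_norm_sub_add_norm_sub y (β.curve t₀) (β.curve s₀)
          linarith
        have e3 : (K : ℝ) * ‖y - β.curve s₀‖ ≤ K * δ := mul_le_mul_of_nonneg_left e2 K.coe_nonneg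
        have e4 := norm_le_norm_add_norm_sub' (P.dynamics y u) (P.dynamics (β.curve s₀) u)
        have e5 : ‖P.dynamics (β.curve s₀) u‖ ≤ ‖φ‖ + w s₀ :=
          (norm_le_norm_add_norm_sub' (g s₀) (φ s₀)).trans
            (add_le_add (φ.norm_coe_le_norm s₀) le_rfl)
        rw [h01]
        calc (‖P.dynamics y u‖ + K * (δ / 2)) * h
            ≤ (‖φ‖ + w s₀ + K * δ + K * (δ / 2)) * h :=
              mul_le_mul_of_nonneg_right (by linarith) hh0.le
          _ = h * (‖φ‖ + K * δ + K * (δ / 2)) + h * w s₀ := by ring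
          _ < δ / 2 := by linarith
      obtain ⟨y', hstep, hy'⟩ := exists_robustStep hK β hfree ht₀0 (by linarith) ht₁T
        (h01 ▸ hhmax.le) huU hvi hdefect hclose hspeed
      exact ⟨y', hy.tail hstep, hy'.trans hbound⟩
  obtain ⟨y, hy, hyT⟩ := claim (N + 1) (by push_cast; exact le_rfl)
  refine ⟨y, hy, ?_⟩
  push_cast at hyT
  rw [hhT] at hyT
  rw [dist_eq_norm]
  exact (hyT.trans (mul_le_mul_of_nonneg_right hψT hC0.le)).trans_lt
    (hηε.trans_le (min_le_left _ _))

theorem exists_ball_subset_of_clearance_pos {β : Trajectory P} (h : 0 < β.clearance) :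
    ∃ δ > 0, ∀ t ∈ Icc 0 β.duration, Metric.ball (β.curve t) δ ⊆ P.free := by
  obtain ⟨δ, hδ⟩ := lt_iSup_iff.1 h
  obtain ⟨hfree, hδ⟩ := lt_iSup_iff.1 hδ
  exact ⟨δ, by exact_mod_cast hδ, hfree⟩

/-! ### Invariants of the search -/

theorem SearchTree.Connects.insert {G : SearchTree P} {x y : EuclideanSpace ℝ (Fin n)}
    (h : G.Connects x y) (v : Node n) (e : Trajectory P) : (G.insert v e).Connects x y := by
  induction h with
  | refl => exact .refl
  | tail _ h ih =>
    obtain ⟨e', he', h'⟩ := h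
    exact ih.tail ⟨e', List.mem_append_left _ he', h'⟩

/-- The invariants of the search state: forward nodes are free states connected to the start, the
queue consists of forward nodes, and the algorithm returns only when it has reached the goal. -/
structure SearchState.Consistent (s : SearchState P) : Prop where
  start_mem : ∃ v ∈ s.fwd.nodes, v.pos = P.start
  free : ∀ v ∈ s.fwd.nodes, v.pos ∈ P.free
  connected : ∀ v ∈ s.fwd.nodes, s.fwd.Connects P.start v.pos
  queue_subset : ∀ p ∈ s.queue, p.1 ∈ s.fwd.nodes
  goal_of_returned : s.returned → ∃ v ∈ s.fwd.nodes, v.pos ∈ P.goal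

theorem SearchState.Consistent.init : (SearchState.init P).Consistent where
  start_mem := ⟨⟨P.start, 0⟩, List.mem_singleton_self _, rfl⟩
  free v hv := by
    rw [List.mem_singleton.1 hv]
    exact P.start_mem
  connected v hv := by
    rw [List.mem_singleton.1 hv]
    exact .refl
  queue_subset p hp := absurd hp List.not_mem_nil
  goal_of_returned h := h.elim

theorem exists_mem_of_mem_updateQueue {S : Settings P} {G : SearchTree P} {Q : List (Node n × ℝ)}
    {w : Node n} {r : ℝ} {p : Node n × ℝ} (hp : p ∈ updateQueue S G Q w r) :
    ∃ p' ∈ Q, p'.1 = p.1 := by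
  unfold updateQueue at hp
  split at hp
  · exact ⟨p, hp, rfl⟩
  · split_ifs at hp
    · obtain ⟨p', hp', rfl⟩ := List.mem_map.1 hp
      refine ⟨p', hp', ?_⟩
      split_ifs <;> rfl
    · exact ⟨p, hp, rfl⟩

theorem mem_or_eq_of_mem_insertToQueue {S : Settings P} {G : SearchTree P}
    {Q : List (Node n × ℝ)} {v : Node n} {r : ℝ} {p : Node n × ℝ}
    (hp : p ∈ insertToQueue S G Q v r) : p ∈ Q ∨ p.1 = v := by
  unfold insertToQueue at hp
  split at hp
  · exact .inl hp
  · split_ifs at hp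
    · rcases List.mem_append.1 hp with h | h
      · exact .inl h
      · exact .inr (by rw [List.mem_singleton.1 h])
    · exact .inl hp

theorem popQueue_subset {Q : List (Node n × ℝ)} : (popQueue Q).2 ⊆ Q := by
  classical
  unfold popQueue
  split
  · exact List.Subset.refl _
  · exact fun _ h => List.mem_of_mem_erase h

theorem exists_mem_of_popQueue_eq_some {Q : List (Node n × ℝ)} {v : Node n}
    (h : (popQueue Q).1 = some v) : ∃ p ∈ Q, p.1 = v := by
  unfold popQueue at h
  split at h
  · cases h
  · next p hp => exact ⟨p, List.argmin_mem hp, Option.some.inj h⟩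

section

variable {Ξ : Type*} {S : Settings P} {R : Routines P Ξ} {k : ℕ} {r : ℝ} {s : SearchState P}

@[simp]
theorem expandReverse_fwd (ξ : Ξ) : (expandReverse S R k r ξ s).fwd = s.fwd := by
  unfold expandReverse
  split
  · rfl
  · split_ifs <;> rfl

@[simp]
theorem expandReverse_returned (ξ : Ξ) : (expandReverse S R k r ξ s).returned = s.returned := by
  unfold expandReverse
  split
  · rfl
  · split_ifs <;> rfl

theorem SearchState.Consistent.expandReverse (hs : s.Consistent) (ξ : Ξ) :
    (expandReverse S R k r ξ s).Consistent where
  start_mem := by simpa using hs.start_mem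
  free := by simpa using hs.free
  connected := by simpa using hs.connected
  queue_subset := by
    rw [expandReverse_fwd]
    unfold GBRRT.expandReverse
    split
    · exact hs.queue_subset
    · split_ifs
      · intro p hp
        obtain ⟨p', hp', h⟩ := exists_mem_of_mem_updateQueue hp
        exact h ▸ hs.queue_subset p' hp'
      · exact hs.queue_subset
  goal_of_returned := by simpa using hs.goal_of_returned

theorem forRandomExplore_eq_some {G : SearchTree P} {x : EuclideanSpace ℝ (Fin n)} {t : ℝ}
    {u : EuclideanSpace ℝ (Fin m)} {v : Node n} {e : Trajectory P}
    (h : forRandomExplore S G x t u = some (v, e)) :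
    v ∈ G.nodes ∧ nearestTo S G x = some v ∧ e.initialNode = v.pos ∧ e.duration = t ∧
      ∀ s ∈ Icc 0 t, e.control s = u := by
  obtain ⟨w, hw, h⟩ := Option.bind_eq_some_iff.1 h
  obtain ⟨e', he', h⟩ := Option.map_eq_some_iff.1 h
  obtain ⟨rfl, rfl⟩ := Prod.mk.inj h
  unfold monteCarloProp at he'
  split_ifs at he' with h1
  have h2 := h1.choose_spec
  rw [Option.some.inj he'] at h2
  exact ⟨List.argmin_mem (Option.mem_def.2 hw), hw, h2⟩

theorem forwardCandidate_queue_subset (d : Draw n m Ξ) :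
    (forwardCandidate S R k r d s).2 ⊆ s.queue := by
  obtain ⟨c, x, t, u, ξ⟩ := d
  simp only [forwardCandidate]
  split_ifs
  · split <;> exact popQueue_subset
  · exact List.Subset.refl _

theorem forwardCandidate_eq_some (hs : ∀ p ∈ s.queue, p.1 ∈ s.fwd.nodes) {d : Draw n m Ξ}
    {v : Node n} {e : Trajectory P} (h : (forwardCandidate S R k r d s).1 = some (v, e)) :
    v ∈ s.fwd.nodes ∧ e.initialNode = v.pos := by
  obtain ⟨c, x, t, u, ξ⟩ := d
  have hrand : forRandomExplore S s.fwd x t u = some (v, e) →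
      v ∈ s.fwd.nodes ∧ e.initialNode = v.pos := fun h =>
    ⟨(forRandomExplore_eq_some h).1, (forRandomExplore_eq_some h).2.2.1⟩
  simp only [forwardCandidate] at h
  split_ifs at h
  · split at h
    · next ve hve =>
      obtain rfl := Option.some.inj h
      split at hve
      · next ve' hve' =>
        obtain rfl := Option.some.inj hve
        obtain ⟨w, hw, h1⟩ := Option.bind_eq_some_iff.1 hve'
        obtain ⟨e', he', h1⟩ := Option.map_eq_some_iff.1 h1
        obtain ⟨rfl, rfl⟩ := Prod.mk.inj h1
        obtain ⟨p, hp, rfl⟩ := exists_mem_of_popQueue_eq_some hw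
        exact ⟨hs p hp, R.forExploit_spec _ _ _ _ _ _ he'⟩
      · exact R.forFastExplore_spec k
          { s with queue := (popQueue s.queue).2 } _ _ _ hve
    · exact hrand h
  · exact hrand h

theorem SearchState.Consistent.expandForward (hs : s.Consistent) (d : Draw n m Ξ) :
    (expandForward S R k r d s).Consistent ∧
      s.fwd.nodes ⊆ (GBRRT.expandForward S R k r d s).fwd.nodes := by
  have hQ := forwardCandidate_queue_subset (S := S) (R := R) (k := k) (r := r) (s := s) d
  have hc := fun v e => forwardCandidate_eq_some (S := S) (R := R) (k := k) (r := r)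
    hs.queue_subset (d := d) (v := v) (e := e)
  unfold GBRRT.expandForward
  rcases hfc : forwardCandidate S R k r d s with ⟨_ | ⟨v, e⟩, Q⟩
  all_goals rw [hfc] at hQ
  · exact ⟨⟨hs.start_mem, hs.free, hs.connected, fun p hp => hs.queue_subset p (hQ hp),
      hs.goal_of_returned⟩, List.Subset.refl _⟩
  · obtain ⟨hv, hev⟩ := hc v e (by rw [hfc])
    simp only
    by_cases hvalid : e.IsValid
    swap
    · rw [if_neg hvalid]
      exact ⟨⟨hs.start_mem, hs.free, hs.connected, fun p hp => hs.queue_subset p (hQ hp),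
        hs.goal_of_returned⟩, List.Subset.refl _⟩
    rw [if_pos hvalid]
    set w : Node n := ⟨e.finalNode, v.cost + S.cost e⟩ with hw
    have hsub : s.fwd.nodes ⊆ (s.fwd.insert w e).nodes := List.subset_append_left _ _
    have hwmem : w ∈ (s.fwd.insert w e).nodes :=
      List.mem_append_right _ (List.mem_singleton_self _)
    have hcases : ∀ v' ∈ (s.fwd.insert w e).nodes, v' ∈ s.fwd.nodes ∨ v' = w := fun v' hv' =>
      (List.mem_append.1 hv').imp id List.mem_singleton.1
    have hfree : ∀ v' ∈ (s.fwd.insert w e).nodes, v'.pos ∈ P.free := fun v' hv' =>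
      (hcases v' hv').elim (hs.free v') fun h => h ▸ hvalid _ ⟨e.duration_nonneg, le_rfl⟩
    have hconn : ∀ v' ∈ (s.fwd.insert w e).nodes,
        (s.fwd.insert w e).Connects P.start v'.pos := by
      intro v' hv'
      rcases hcases v' hv' with h | rfl
      · exact (hs.connected v' h).insert w e
      · exact ((hs.connected v hv).insert w e).tail
          ⟨e, List.mem_append_right _ (List.mem_singleton_self _), hvalid, hev, rfl⟩
    obtain ⟨v₀, hv₀, hv₀'⟩ := hs.start_mem
    split_ifs with hg
    · exact ⟨⟨⟨v₀, hsub hv₀, hv₀'⟩, hfree, hconn,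
        fun p hp => hsub (hs.queue_subset p (hQ hp)), fun _ => ⟨w, hwmem, hg⟩⟩, hsub⟩
    · refine ⟨⟨⟨v₀, hsub hv₀, hv₀'⟩, hfree, hconn, fun p hp => ?_, fun h => ?_⟩, hsub⟩
      · rcases mem_or_eq_of_mem_insertToQueue hp with h | h
        · exact hsub (hs.queue_subset p (hQ h))
        · rw [h]
          exact hwmem
      · obtain ⟨v', hv', h'⟩ := hs.goal_of_returned h
        exact ⟨v', hsub hv', h'⟩

theorem SearchState.Consistent.iteration (hs : s.Consistent) (d : Draw n m Ξ) :
    (iteration S R k d s).Consistent ∧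
      s.fwd.nodes ⊆ (GBRRT.iteration S R k d s).fwd.nodes := by
  unfold GBRRT.iteration
  split_ifs
  · exact ⟨hs, List.Subset.refl _⟩
  · have h := (hs.expandReverse (S := S) (R := R) (k := k) (r := radius S s)
      d.2.2.2.2).expandForward (S := S) (R := R) (k := k) (r := radius S s) d
    rwa [expandReverse_fwd] at h

theorem run_consistent (S : Settings P) (R : Routines P Ξ) (d : ℕ → Draw n m Ξ) (k : ℕ) :
    (run S R d k).Consistent := by
  induction k with
  | zero => exact .init
  | succ k ih => exact (ih.iteration _).1

/-- The search has either returned or inserted a forward node into the ball of centre `x` and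
radius `ε`. -/
def SearchState.Reaches (s : SearchState P) (x : EuclideanSpace ℝ (Fin n)) (ε : ℝ) : Prop :=
  s.returned ∨ ∃ v ∈ s.fwd.nodes, v.pos ∈ Metric.ball x ε

theorem SearchState.Reaches.iteration {x : EuclideanSpace ℝ (Fin n)} {ε : ℝ}
    (h : s.Reaches x ε) (hs : s.Consistent) (d : Draw n m Ξ) :
    (GBRRT.iteration S R k d s).Reaches x ε := by
  rcases h with h | ⟨v, hv, hx⟩
  · left
    unfold GBRRT.iteration
    rwa [if_pos h]
  · exact .inr ⟨v, (hs.iteration d).2 hv, hx⟩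

theorem SearchState.Reaches.run_mono {d : ℕ → Draw n m Ξ} {x : EuclideanSpace ℝ (Fin n)} {ε : ℝ}
    {j k : ℕ} (h : (run S R d j).Reaches x ε) (hjk : j ≤ k) : (run S R d k).Reaches x ε := by
  induction k, hjk using Nat.le_induction with
  | base => exact h
  | succ k _ ih => exact ih.iteration (run_consistent S R d k) (d k)

theorem SearchState.Reaches.solved {x : EuclideanSpace ℝ (Fin n)} {ε : ℝ} (h : s.Reaches x ε)
    (hs : s.Consistent) (hx : Metric.ball x ε ⊆ P.goal) : Solved P s.fwd := by
  obtain ⟨v, hv, hg⟩ : ∃ v ∈ s.fwd.nodes, v.pos ∈ P.goal := by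
    rcases h with h | ⟨v, hv, h⟩
    · exact hs.goal_of_returned h
    · exact ⟨v, hv, hx h⟩
  exact ⟨v.pos, ⟨hg, v, hv, rfl⟩, hs.connected v hv⟩

/-! ### Random exploration reproduces robust steps -/

/-- Near an interior point `x`, whichever state minimises the distance to a sample close to `x`
is itself close to `x`, provided that some competitor is. -/
theorem IsCompatibleDistance.exists_nearest_close {X : Set (EuclideanSpace ℝ (Fin n))}
    {d : EuclideanSpace ℝ (Fin n) → EuclideanSpace ℝ (Fin n) → ℝ} (hd : IsCompatibleDistance X d)
    {x : EuclideanSpace ℝ (Fin n)} (hx : x ∈ interior X) {ε : ℝ} (hε : 0 < ε) :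
    ∃ ρ > 0, Metric.ball x ρ ⊆ X ∧ ∀ z ∈ Metric.ball x ρ, ∀ v ∈ Metric.ball x ρ, ∀ w ∈ X,
      d w z ≤ d v z → dist w x < ε := by
  obtain ⟨η, hη, hsmall⟩ := hd.dist_small x hx ε hε
  have h1 := (hd.tendsto_left x hx).eventually (gt_mem_nhds (show 0 < η / 3 by linarith))
  have h2 := (hd.tendsto_right x hx).eventually (gt_mem_nhds (show 0 < η / 3 by linarith))
  obtain ⟨ρ, hρ, h⟩ := Metric.eventually_nhds_iff_ball.1
    ((h1.and h2).and (mem_interior_iff_mem_nhds.1 hx))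
  have hxX := interior_subset hx
  refine ⟨ρ, hρ, fun z hz => (h z hz).2, fun z hz v hv w hw hle => hsmall w hw ?_⟩
  have e1 := hd.triangle w hw z (h z hz).2 x hxX
  have e2 := hd.triangle v (h v hv).2 x hxX z (h z hz).2
  have e3 := (h z hz).1.1
  have e4 := (h z hz).1.2
  have e5 := (h v hv).1.1
  linarith

theorem iteration_eq_of_exploitRatio_le {d : Draw n m Ξ} (hs : ¬ s.returned)
    (hd : S.exploitRatio k ≤ d.1) {v : Node n} {e : Trajectory P}
    (hve : forRandomExplore S s.fwd d.2.1 d.2.2.1 d.2.2.2.1 = some (v, e)) (he : e.IsValid) :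
    ∃ w ∈ (iteration S R k d s).fwd.nodes, w.pos = e.finalNode := by
  obtain ⟨c, x, t, u, ξ⟩ := d
  refine ⟨⟨e.finalNode, v.cost + S.cost e⟩, ?_, rfl⟩
  have hc : ¬ c < S.exploitRatio k := not_lt.2 hd
  simp only at hve
  simp only [iteration, if_neg hs, expandForward, forwardCandidate, if_neg hc, expandReverse_fwd,
    hve, if_pos he]
  split_ifs <;> simp [SearchTree.insert]

/-- The random exploration turns a node close to the beginning of a robust step into a node close
to its end, whenever the draw falls into a suitable set of positive probability. -/
theorem RobustStep.exists_draws {K L : ℝ≥0} (hK : P.LipschitzInState K)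
    (hL : ∀ x ∈ P.stateSpace, LipschitzOnWith L (P.dynamics x) P.controlSet)
    (hX_meas : MeasurableSet P.stateSpace) (hX_fin : volume P.stateSpace ≠ ∞)
    (hU_meas : MeasurableSet P.controlSet) (hU_fin : volume P.controlSet ≠ ∞)
    (hU_pos : ∀ u ∈ P.controlSet, ∀ ε > 0, 0 < volume (Metric.ball u ε ∩ P.controlSet))
    (hd : IsCompatibleDistance P.stateSpace S.distance)
    {q : ℝ} (hq : q < 1) (hratio : ∀ k, S.exploitRatio k ≤ q)
    [MeasurableSpace Ξ] (ν : Measure Ξ) [IsProbabilityMeasure ν] (R : Routines P Ξ)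
    {x y : EuclideanSpace ℝ (Fin n)} (h : RobustStep P K S.maxTime x y) {ε : ℝ} (hε : 0 < ε) :
    ∃ ρ > 0, ∃ A : Set (Draw n m Ξ), MeasurableSet A ∧ drawLaw P S ν A ≠ 0 ∧
      ∀ (k : ℕ) (s : SearchState P) (d : Draw n m Ξ), s.Consistent → s.Reaches x ρ → d ∈ A →
        (iteration S R k d s).Reaches y ε := by
  obtain ⟨u, hu, τ, r, hr, hrτ, hτ, hball, hstep⟩ := h.perturb hK hL hε
  have hX : P.free ⊆ P.stateSpace := sdiff_subset
  have hx : x ∈ interior P.stateSpace := mem_interior.2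
    ⟨Metric.ball x r, hball.trans hX, Metric.isOpen_ball, Metric.mem_ball_self hr⟩
  obtain ⟨ρ, hρ, hρX, hnear⟩ := hd.exists_nearest_close hx hr
  refine ⟨ρ, hρ, Ici q ×ˢ (Metric.ball x ρ ×ˢ (Ioc (τ - r) τ ×ˢ
    ((Metric.ball u r ∩ P.controlSet) ×ˢ univ))), ?_, ?_, ?_⟩
  · exact measurableSet_Ici.prod (Metric.isOpen_ball.measurableSet.prod (measurableSet_Ioc.prod
      ((Metric.isOpen_ball.measurableSet.inter hU_meas).prod .univ)))
  · have hcond : ∀ {α : Type} [MeasurableSpace α] (μ : Measure α) {s t : Set α},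
        MeasurableSet s → μ s ≠ ∞ → μ (s ∩ t) ≠ 0 → cond μ s t ≠ 0 := by
      intro α _ μ s t hs hs' h0
      rw [cond_apply hs]
      exact mul_ne_zero (ENNReal.inv_ne_zero.2 hs') h0
    rw [drawLaw, Measure.prod_prod, Measure.prod_prod, Measure.prod_prod, Measure.prod_prod,
      measure_univ, mul_one]
    refine mul_ne_zero ?_ (mul_ne_zero ?_ (mul_ne_zero ?_ ?_))
    · refine hcond _ measurableSet_Icc (by simp) fun h0 => ?_
      have h1 : Icc (max q 0) 1 ⊆ Icc (0 : ℝ) 1 ∩ Ici q := fun c hc =>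
        ⟨⟨(le_max_right _ _).trans hc.1, hc.2⟩, (le_max_left _ _).trans hc.1⟩
      have h2 := measure_mono_null h1 h0
      rw [Real.volume_Icc, ENNReal.ofReal_eq_zero, sub_nonpos] at h2
      exact absurd h2 (not_le.2 (max_lt hq one_pos))
    · refine hcond _ hX_meas hX_fin ?_
      rw [inter_eq_self_of_subset_right hρX]
      exact (Metric.measure_ball_pos volume x hρ).ne'
    · refine hcond _ measurableSet_Icc (by simp) ?_
      have h1 : Ioc (τ - r) τ ⊆ Icc 0 S.maxTime := fun t ht =>
        ⟨by linarith [ht.1], ht.2.trans hτ⟩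
      rw [inter_eq_self_of_subset_right h1, Real.volume_Ioc]
      simpa using hr
    · refine hcond _ hU_meas hU_fin ?_
      rw [inter_eq_self_of_subset_right inter_subset_right]
      exact (hU_pos u hu r hr).ne'
  · rintro k s ⟨c, z, t, u', ξ⟩ hs hreach ⟨hc, hz, ht, hu', -⟩
    simp only at hc hz ht hu'
    by_cases hret : s.returned
    · exact SearchState.Reaches.iteration (.inl hret) hs _
    obtain ⟨v, hv, hvx⟩ := hreach.resolve_left hret
    obtain ⟨w, hw⟩ : ∃ w, nearestTo S s.fwd z = some w := by
      rw [← Option.ne_none_iff_exists']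
      intro h0
      rw [nearestTo, List.argmin_eq_none] at h0
      rw [h0] at hv
      exact absurd hv List.not_mem_nil
    have hwn : w ∈ s.fwd.nodes := List.argmin_mem (Option.mem_def.2 hw)
    have hwx : w.pos ∈ Metric.ball x r := hnear z hz v.pos hvx w.pos (hX (hs.free w hwn))
      (List.le_of_mem_argmin hv (Option.mem_def.2 hw))
    obtain ⟨hex, hall⟩ := hstep w.pos hwx u' hu' t ht
    obtain ⟨e, he⟩ : ∃ e, forRandomExplore S s.fwd z t u' = some (w, e) := by
      refine ⟨hex.choose, ?_⟩
      simp [forRandomExplore, hw, monteCarloProp, dif_pos hex]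
    obtain ⟨-, -, he1, he2, he3⟩ := forRandomExplore_eq_some he
    obtain ⟨hvalid, hfin⟩ := hall e he1 he2 he3
    obtain ⟨w', hw', hw''⟩ := iteration_eq_of_exploitRatio_le (R := R) (k := k)
      (d := (c, z, t, u', ξ)) hret ((hratio k).trans hc) he hvalid
    exact .inr ⟨w', hw', hw'' ▸ hfin⟩

end

/-! ### Exponential decay of the failure probability -/

/-- A step of the induction along the chain: the search misses the target `z` after `k` iterations
only if it has missed the previous target `y` after `k / 2` iterations, or if none of the
remaining draws is favourable. Only the second event is known to be measurable. -/
theorem exponential_decay_step {Ξ : Type*} [MeasurableSpace Ξ] {S : Settings P}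
    {R : Routines P Ξ} {Ω : Type*} [MeasurableSpace Ω] {μ : Measure Ω}
    {D : ℕ → Ω → Draw n m Ξ} (hD_meas : ∀ k, Measurable (D k)) {law : Measure (Draw n m Ξ)}
    [IsProbabilityMeasure law] (hD_law : ∀ k, μ.map (D k) = law) (hD_indep : iIndepFun D μ)
    {y z : EuclideanSpace ℝ (Fin n)} {ρ ε : ℝ} {A : Set (Draw n m Ξ)} (hA : MeasurableSet A)
    (hA0 : law A ≠ 0)
    (hstep : ∀ (k : ℕ) (s : SearchState P) (d : Draw n m Ξ), s.Consistent → s.Reaches y ρ →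
      d ∈ A → (iteration S R k d s).Reaches z ε)
    (hy : ∃ a b : ℝ, 0 < a ∧ 0 < b ∧ ∀ k : ℕ,
      μ {ω | ¬ (run S R (fun j => D j ω) k).Reaches y ρ} ≤ ENNReal.ofReal (a * Real.exp (-b * k))) :
    ∃ a b : ℝ, 0 < a ∧ 0 < b ∧ ∀ k : ℕ,
      μ {ω | ¬ (run S R (fun j => D j ω) k).Reaches z ε} ≤
        ENNReal.ofReal (a * Real.exp (-b * k)) := by
  obtain ⟨a, b, ha, hb, hab⟩ := hy
  -- the probability of an unfavourable draw is at most `exp (-c)`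
  obtain ⟨c, hc, hAc⟩ : ∃ c > 0, law Aᶜ ≤ ENNReal.ofReal (Real.exp (-c)) := by
    have h1 : law Aᶜ < 1 := by
      rw [prob_compl_eq_one_sub hA]
      exact ENNReal.sub_lt_self ENNReal.one_ne_top one_ne_zero hA0
    have h2 : (law Aᶜ).toReal < 1 := by
      rw [← ENNReal.toReal_one]
      exact (ENNReal.toReal_lt_toReal h1.ne_top ENNReal.one_ne_top).2 h1
    have h3 : 0 < max (law Aᶜ).toReal (1 / 2) := lt_max_of_lt_right (by norm_num)
    refine ⟨-Real.log (max (law Aᶜ).toReal (1 / 2)), ?_, ?_⟩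
    · exact neg_pos.2 (Real.log_neg h3 (max_lt h2 (by norm_num)))
    · rw [neg_neg, Real.exp_log h3]
      exact (ENNReal.le_ofReal_iff_toReal_le h1.ne_top h3.le).2 (le_max_left _ _)
  refine ⟨a * Real.exp (b / 2) + 1, min b c / 2, by positivity, half_pos (lt_min hb hc),
    fun k => ?_⟩
  have hsub : {ω | ¬ (run S R (fun j => D j ω) k).Reaches z ε} ⊆
      {ω | ¬ (run S R (fun j => D j ω) (k / 2)).Reaches y ρ} ∪
        ⋂ j ∈ Finset.Ico (k / 2) k, D j ⁻¹' Aᶜ := by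
    intro ω hω
    by_contra hcon
    simp only [mem_union, not_or, mem_ofPred_eq, not_not, mem_iInter, not_forall] at hcon
    obtain ⟨h1, j, hj, h2⟩ := hcon
    rw [Finset.mem_Ico] at hj
    have h3 := hstep (j + 1) _ (D j ω) (run_consistent S R (fun j => D j ω) j)
      (h1.run_mono hj.1) (not_not.1 h2)
    exact hω (SearchState.Reaches.run_mono (j := j + 1) h3 hj.2)
  have hprod : μ (⋂ j ∈ Finset.Ico (k / 2) k, D j ⁻¹' Aᶜ) ≤
      ENNReal.ofReal (Real.exp (-c * (k - (k / 2 : ℕ)))) := by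
    rw [hD_indep.measure_inter_preimage_eq_mul _ fun _ _ => hA.compl]
    have h1 : ∀ j, μ (D j ⁻¹' Aᶜ) = law Aᶜ := fun j => by
      rw [← hD_law j, Measure.map_apply (hD_meas j) hA.compl]
    simp only [h1, Finset.prod_const, Nat.card_Ico]
    calc law Aᶜ ^ (k - k / 2) ≤ ENNReal.ofReal (Real.exp (-c)) ^ (k - k / 2) := by gcongr
      _ = ENNReal.ofReal (Real.exp (-c * (k - (k / 2 : ℕ)))) := by
        rw [← ENNReal.ofReal_pow (Real.exp_pos _).le, ← Real.exp_nat_mul,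
          Nat.cast_sub (Nat.div_le_self k 2)]
        ring_nf
  have hk1 : ((k / 2 : ℕ) : ℝ) ≤ k / 2 := Nat.cast_div_le
  have hk2 : (k : ℝ) / 2 - 1 / 2 ≤ (k / 2 : ℕ) := by
    have : k ≤ 2 * (k / 2) + 1 := by omega
    have : (k : ℝ) ≤ 2 * (k / 2 : ℕ) + 1 := by exact_mod_cast this
    linarith
  have hk0 : (0 : ℝ) ≤ k := k.cast_nonneg
  refine (measure_mono hsub).trans ((measure_union_le _ _).trans
    ((add_le_add (hab (k / 2)) hprod).trans ?_))
  rw [← ENNReal.ofReal_add (by positivity) (Real.exp_pos _).le]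
  refine ENNReal.ofReal_le_ofReal ?_
  have e1 : Real.exp (-b * (k / 2 : ℕ)) ≤ Real.exp (b / 2) * Real.exp (-(min b c / 2) * k) := by
    rw [← Real.exp_add, Real.exp_le_exp]
    nlinarith [mul_le_mul_of_nonneg_left hk2 hb.le,
      mul_le_mul_of_nonneg_right (min_le_left b c) hk0]
  have e2 : Real.exp (-c * (k - (k / 2 : ℕ))) ≤ Real.exp (-(min b c / 2) * k) := by
    rw [Real.exp_le_exp]
    nlinarith [mul_le_mul_of_nonneg_left hk1 hc.le,
      mul_le_mul_of_nonneg_right (min_le_right b c) hk0]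
  have e3 := mul_le_mul_of_nonneg_left e1 ha.le
  linarith

/-- `drawLaw` is the zero measure if one of the sampled sets is null; this is excluded when it is
the law of a random variable. -/
theorem isProbabilityMeasure_drawLaw {S : Settings P} {Ξ : Type*} [MeasurableSpace Ξ]
    {Ω : Type*} [MeasurableSpace Ω] {μ : Measure Ω} [IsProbabilityMeasure μ]
    {ν : Measure Ξ} {D : Ω → Draw n m Ξ} (hD_meas : Measurable D)
    (hD_law : μ.map D = drawLaw P S ν) : IsProbabilityMeasure (drawLaw P S ν) :=
  hD_law ▸ Measure.isProbabilityMeasure_map hD_meas.aemeasurable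

/-- The point at the end of a chain of robust steps is approached by the forward tree, unless the
algorithm has returned, with a failure probability that decays exponentially. -/
theorem exponential_decay_of_chain {Ξ : Type*} [MeasurableSpace Ξ] {S : Settings P}
    {R : Routines P Ξ} {K L : ℝ≥0} (hK : P.LipschitzInState K)
    (hL : ∀ x ∈ P.stateSpace, LipschitzOnWith L (P.dynamics x) P.controlSet)
    (hX_meas : MeasurableSet P.stateSpace) (hX_fin : volume P.stateSpace ≠ ∞)
    (hU_meas : MeasurableSet P.controlSet) (hU_fin : volume P.controlSet ≠ ∞)
    (hU_pos : ∀ u ∈ P.controlSet, ∀ ε > 0, 0 < volume (Metric.ball u ε ∩ P.controlSet))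
    (hd : IsCompatibleDistance P.stateSpace S.distance)
    {q : ℝ} (hq : q < 1) (hratio : ∀ k, S.exploitRatio k ≤ q)
    {ν : Measure Ξ} [IsProbabilityMeasure ν]
    {Ω : Type*} [MeasurableSpace Ω] {μ : Measure Ω} [IsProbabilityMeasure μ]
    {D : ℕ → Ω → Draw n m Ξ} (hD_meas : ∀ k, Measurable (D k))
    (hD_law : ∀ k, μ.map (D k) = drawLaw P S ν) (hD_indep : iIndepFun D μ)
    {y : EuclideanSpace ℝ (Fin n)}
    (hy : Relation.ReflTransGen (RobustStep P K S.maxTime) P.start y) {ε : ℝ} (hε : 0 < ε) :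
    ∃ a b : ℝ, 0 < a ∧ 0 < b ∧ ∀ k : ℕ,
      μ {ω | ¬ (run S R (fun j => D j ω) k).Reaches y ε} ≤
        ENNReal.ofReal (a * Real.exp (-b * k)) := by
  have := isProbabilityMeasure_drawLaw (hD_meas 0) (hD_law 0)
  induction hy generalizing ε with
  | refl =>
    refine ⟨1, 1, one_pos, one_pos, fun k => ?_⟩
    have : {ω | ¬ (run S R (fun j => D j ω) k).Reaches P.start ε} = ∅ := by
      refine eq_empty_of_forall_notMem fun ω hω => hω ?_
      obtain ⟨v, hv, h⟩ := (run_consistent S R (fun j => D j ω) k).start_mem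
      exact .inr ⟨v, hv, h ▸ Metric.mem_ball_self hε⟩
    rw [this, measure_empty]
    exact zero_le
  | tail _ h ih =>
    obtain ⟨ρ, hρ, A, hA, hA0, hstep⟩ := h.exists_draws hK hL hX_meas hX_fin hU_meas hU_fin hU_pos
      hd hq hratio ν R hε
    exact exponential_decay_step hD_meas hD_law hD_indep hA hA0 hstep (ih hρ)

theorem isProbabilisticallyComplete_of_exponential_decay {Ω : Type*} [MeasurableSpace Ω]
    {μ : Measure Ω} [IsProbabilityMeasure μ] {G : ℕ → Ω → SearchTree P} {a b : ℝ} (hb : 0 < b)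
    (h : ∀ k : ℕ, μ {ω | ¬ Solved P (G k ω)} ≤ ENNReal.ofReal (a * Real.exp (-b * k))) :
    IsProbabilisticallyComplete P μ G := by
  refine Tendsto.liminf_eq ?_
  have h1 : Tendsto (fun k : ℕ => 1 - ENNReal.ofReal (a * Real.exp (-b * k))) atTop (𝓝 1) := by
    have h2 : Tendsto (fun k : ℕ => a * Real.exp (-b * k)) atTop (𝓝 0) := by
      have h3 : Tendsto (fun k : ℕ => -b * (k : ℝ)) atTop atBot :=
        tendsto_natCast_atTop_atTop.const_mul_atTop_of_neg (neg_lt_zero.2 hb)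
      simpa using (Real.tendsto_exp_atBot.comp h3).const_mul a
    have h4 := ENNReal.tendsto_ofReal h2
    rw [ENNReal.ofReal_zero] at h4
    simpa using ENNReal.Tendsto.sub (tendsto_const_nhds (x := (1 : ℝ≥0∞))) h4
      (.inl ENNReal.one_ne_top)
  refine tendsto_of_tendsto_of_tendsto_of_le_of_le h1 tendsto_const_nhds (fun k => ?_)
    fun k => prob_le_one
  rw [tsub_le_iff_right]
  calc (1 : ℝ≥0∞) = μ univ := measure_univ.symm
    _ ≤ μ ({ω | Solved P (G k ω)} ∪ {ω | ¬ Solved P (G k ω)}) :=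
      measure_mono fun ω _ => em (Solved P (G k ω))
    _ ≤ μ {ω | Solved P (G k ω)} + ENNReal.ofReal (a * Real.exp (-b * k)) :=
      (measure_union_le _ _).trans (add_le_add le_rfl (h k))

end GBRRT

theorem mainTheorem1 {n m : ℕ} (P : GBRRT.PlanningProblem n m) (S : GBRRT.Settings P)
    -- the state space and the control set admit uniform sampling, and the latter charges every
    -- relatively open part of the control set
    (hX_meas : MeasurableSet P.stateSpace) (hX_fin : volume P.stateSpace ≠ ∞)
    (hU_meas : MeasurableSet P.controlSet) (hU_fin : volume P.controlSet ≠ ∞)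
    (hU_pos : ∀ u ∈ P.controlSet, ∀ ε > 0, 0 < volume (Metric.ball u ε ∩ P.controlSet))
    (hLip : P.IsLipschitz)
    -- there is a solution path of positive clearance, ending inside the goal region
    (hsol : ∃ β : GBRRT.Trajectory P, β.initialNode = P.start ∧ β.finalNode ∈ interior P.goal ∧
      0 < β.clearance)
    (hT : 0 < S.maxTime)
    (hd : GBRRT.IsCompatibleDistance P.stateSpace S.distance)
    (q : ℝ) (hq : q < 1) (hratio : ∀ k, 0 ≤ S.exploitRatio k ∧ S.exploitRatio k ≤ q)
    -- arbitrary reverse search, exploitation and fast exploration subroutines, with random seeds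
    {Ξ : Type*} [MeasurableSpace Ξ] (ν : Measure Ξ) [IsProbabilityMeasure ν]
    (R : GBRRT.Routines P Ξ)
    -- the draws of the successive iterations are independent and identically distributed
    {Ω : Type*} [MeasurableSpace Ω] (μ : Measure Ω) [IsProbabilityMeasure μ]
    (D : ℕ → Ω → GBRRT.Draw n m Ξ) (hD_meas : ∀ k, Measurable (D k))
    (hD_law : ∀ k, μ.map (D k) = GBRRT.drawLaw P S ν) (hD_indep : iIndepFun D μ) :
    GBRRT.IsProbabilisticallyComplete P μ (fun k ω => (GBRRT.run S R (fun j => D j ω) k).fwd) ∧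
    ∃ a b : ℝ, 0 < a ∧ 0 < b ∧ ∀ k : ℕ,
      μ {ω | ¬ GBRRT.Solved P (GBRRT.run S R (fun j => D j ω) k).fwd} ≤
        ENNReal.ofReal (a * Real.exp (-b * k)) := by
  obtain ⟨Kx, Ku, hKx, hKu, hlip⟩ := hLip
  have hK : P.LipschitzInState ⟨Kx, hKx.le⟩ := fun u hu =>
    LipschitzOnWith.of_dist_le_mul fun x hx y hy => by
      rw [dist_eq_norm, dist_eq_norm]
      exact (hlip x hx y hy u hu u hu).1
  have hL : ∀ x ∈ P.stateSpace, LipschitzOnWith ⟨Ku, hKu.le⟩ (P.dynamics x) P.controlSet :=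
    fun x hx => LipschitzOnWith.of_dist_le_mul fun u hu u' hu' => by
      rw [dist_eq_norm, dist_eq_norm]
      exact (hlip x hx x hx u hu u' hu').2
  obtain ⟨β, hβ0, hβ1, hclear⟩ := hsol
  obtain ⟨δ, hδ, hfree⟩ := GBRRT.exists_ball_subset_of_clearance_pos hclear
  obtain ⟨ε, hε, hgoal⟩ := Metric.mem_nhds_iff.1 (mem_interior_iff_mem_nhds.1 hβ1)
  obtain ⟨y, hy, hyβ⟩ := GBRRT.exists_robustStep_chain hK β hδ hfree hT (half_pos hε)
  rw [hβ0] at hy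
  have hball : Metric.ball y (ε / 2) ⊆ P.goal :=
    (Metric.ball_subset_ball' (by linarith)).trans hgoal
  obtain ⟨a, b, ha, hb, hab⟩ := GBRRT.exponential_decay_of_chain (R := R) hK hL hX_meas hX_fin
    hU_meas hU_fin hU_pos hd hq (fun k => (hratio k).2) hD_meas hD_law hD_indep hy (half_pos hε)
  have hfail : ∀ k : ℕ, μ {ω | ¬ GBRRT.Solved P (GBRRT.run S R (fun j => D j ω) k).fwd} ≤
      ENNReal.ofReal (a * Real.exp (-b * k)) := fun k => by
    refine le_trans (measure_mono fun ω hω => ?_) (hab k)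
    exact fun hreach => hω
      (hreach.solved (GBRRT.run_consistent S R (fun j => D j ω) k) hball)
  exact ⟨GBRRT.isProbabilisticallyComplete_of_exponential_decay hb hfail, a, b, ha, hb, hfail⟩
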